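/- For $s\ge 2$, $M\in\mathbb R^{s\times s}$ symmetric with non-negative entries and a probability vector $\pi$ on $[s]$, let $\mathcal G(n,M/n,\pi)$ be the law (defined for all large $n$) of the pair $(G,\sigma)$ in which the labels $\sigma_v\in[s]$ of the vertices $v\in\{1,\dots,n\}$ are independent with distribution $\pi$ and, given $\sigma$, each pair $\{u,v\}$ is an edge of $G$ independently with probability $M_{\sigma_u,\sigma_v}/n$. For labellings $\sigma,\tau\in[s]^n$ put $N_i(\sigma)=\#\{v:\sigma_v=i\}$, $N_{ij}(\sigma,\tau)=\#\{v:\sigma_v=i,\tau_v=j\}$ and $$\mathrm{overlap}(\sigma,\tau)=\frac1n\max_\rho\sum_{i\in[s]}\Bigl(N_{i\rho(i)}(\sigma,\tau)-\frac1n N_i(\sigma)N_{\rho(i)}(\tau)\Bigr),$$ the maximum being over all permutations $\rho$ of $[s]$. The model is called reconstructable if there are $\delta>0$ and an algorithm $\mathcal A$ (an arbitrary map from graphs on $n$ vertices to labellings in $[s]^n$, for each $n$) such that $\lim_{n\to\infty}\Pr(\mathrm{overlap}(\mathcal A(G),\sigma)>\delta)$ exists and is positive. **Proposition.** Let $0<p<1$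 and $0\le d<1$, and consider the two-cluster block model with $$M=d\begin{pmatrix}1/p&0\\0&1/(1-p)\end{pmatrix},\qquad \pi=(p,1-p)$$ (two disjoint Erdős–Rényi graphs). If $d>0$, then both eigenvalues of $T=\frac1d\,\mathrm{diag}(\pi)M$, counted with multiplicity, are equal to $1$; in particular $\lambda_2=1$. The model is not reconstructable. More precisely, for every algorithm $\mathcal A$ and every $\delta>0$, $\lim_{n\to\infty}\Pr(\mathrm{overlap}(\mathcal A(G),\sigma)>\delta)=0$. -/

import Mathlib

open Filter Topology

noncomputable section

namespace BlockModel

/-- The joint density of the stochastic block model `𝒢(n, M/n, π)` with `s` communities: the labels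
`σ v` are independent with law `π`, and then every unordered pair `u < v` is an edge independently
with probability `M (σ u) (σ v) / n`. The matrix `M` is meant to be symmetric. (For the finitely many `n`
that are smaller than some entry of `M`, the model does not exist and the formula is merely a formula;
only limits as `n → ∞` are used.) -/
def density {s : ℕ} (n : ℕ) (M : Matrix (Fin s) (Fin s) ℝ) (π : Fin s → ℝ)
    (G : SimpleGraph (Fin n)) (σ : Fin n → Fin s) : ℝ :=
  open Classical in
  (∏ v, π (σ v)) *
    ∏ e : Fin n × Fin n with e.1 < e.2,
      if G.Adj e.1 e.2 then M (σ e.1) (σ e.2) / n else 1 - M (σ e.1) (σ e.2) / n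

/-- The probability of the event `E` for `(G, σ) ∼ 𝒢(n, M/n, π)`. -/
def prob {s : ℕ} (n : ℕ) (M : Matrix (Fin s) (Fin s) ℝ) (π : Fin s → ℝ)
    (E : SimpleGraph (Fin n) → (Fin n → Fin s) → Prop) : ℝ :=
  open Classical in
  ∑ G : SimpleGraph (Fin n), ∑ σ : Fin n → Fin s, if E G σ then density n M π G σ else 0

/-- `N_i(σ)`, the number of vertices with label `i`. -/
def labelCount {s n : ℕ} (σ : Fin n → Fin s) (i : Fin s) : ℕ :=
  (Finset.univ.filter fun v => σ v = i).card

/-- `N_{ij}(σ, τ)`, the number of vertices labelled `i` by `σ` and `j` by `τ`. -/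
def jointCount {s n : ℕ} (σ τ : Fin n → Fin s) (i j : Fin s) : ℕ :=
  (Finset.univ.filter fun v => σ v = i ∧ τ v = j).card

/-- The overlap `(1/n) max_ρ ∑ᵢ (N_{iρ(i)}(σ,τ) - N_i(σ) N_{ρ(i)}(τ) / n)` of two labellings, with
`ρ` running over the permutations of the set of labels. -/
def overlap {s n : ℕ} (σ τ : Fin n → Fin s) : ℝ :=
  (1 / (n : ℝ)) *
    Finset.univ.sup' Finset.univ_nonempty fun ρ : Equiv.Perm (Fin s) =>
      ∑ i, ((jointCount σ τ i (ρ i) : ℝ) - (1 / (n : ℝ)) * labelCount σ i * labelCount τ (ρ i))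

/-- An algorithm: an arbitrary family of maps from graphs on `n` vertices to labellings. It may depend
on the parameters of the model; no computability or efficiency is required. -/
abbrev Algorithm (s : ℕ) : Type :=
  (n : ℕ) → SimpleGraph (Fin n) → (Fin n → Fin s)

/-- The probability, for `(G, σ) ∼ 𝒢(n, M/n, π)`, that `A` achieves an overlap greater than `δ`. -/
def successProb {s : ℕ} (M : Matrix (Fin s) (Fin s) ℝ) (π : Fin s → ℝ) (A : Algorithm s) (δ : ℝ)
    (n : ℕ) : ℝ :=
  prob n M π fun G σ => δ < overlap (A n G) σ

/-- Reconstructability: for some `δ > 0` and some algorithm `A`,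
`lim_{n → ∞} Pr(overlap(A(G), σ) > δ) > 0`. -/
def IsReconstructable {s : ℕ} (M : Matrix (Fin s) (Fin s) ℝ) (π : Fin s → ℝ) : Prop :=
  ∃ δ : ℝ, 0 < δ ∧ ∃ A : Algorithm s, ∃ L : ℝ, 0 < L ∧
    Tendsto (fun n : ℕ => successProb M π A δ n) atTop (𝓝 L)

/-- The matrix `T = (1/d) diag(π) M` of a block model of expected degree `d`. -/
def transitionMatrix {s : ℕ} (d : ℝ) (M : Matrix (Fin s) (Fin s) ℝ) (π : Fin s → ℝ) :
    Matrix (Fin s) (Fin s) ℝ :=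
  (1 / d) • (Matrix.diagonal π * M)

/-- Edge matrix `d · diag(1/p, 1/(1-p))` of two disjoint Erdős–Rényi graphs. -/
def twoClusterMatrix (d p : ℝ) : Matrix (Fin 2) (Fin 2) ℝ :=
  !![d * (1 / p), 0; 0, d * (1 / (1 - p))]

/-- Class distribution `(p, 1-p)`. -/
def twoClusterLaw (p : ℝ) : Fin 2 → ℝ := ![p, 1 - p]

end BlockModel

end

namespace BlockModel

/-! ### Expectations under the block model and their factorisation -/

section Moments

open scoped Classical
open Finset

variable {s n : ℕ}

/-! The proof is a second moment argument. For two labels, every permutation in the overlap gives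
plus or minus twice the empirical covariance of the two labellings (`overlap_le`). So it suffices
that `∑ v, g G v * centred p (σ v)` has second moment `o(n²)` for every bounded weight `g` depending
on the graph alone (`mean_sq_sum_le`). By Chebyshev's inequality the overlap then exceeds `δ` with
vanishing probability.

Expanding the square, one needs the correlation of two centred labels given the graph
(`mean_correlation_le`). Labels are constant on components. Suppose that the component of `u` is a
tree with `k` vertices not containing `v`. Giving it the label `i` contributes `π i ^ k * (d / (π i
* n)) ^ (k - 1) = π i * (d / n) ^ (k - 1)` from vertices and edges, so all powers of `π i` but one
cancel (`density_eq_of_tree`). The missing edges to the other vertices of label `i`, about `π i * n`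
of them, contribute about `exp (-d * k)`, again independently of `i`. The posterior of the label is
thus nearly the prior `π`, and its centred version has mean nearly zero. This is made precise by
pairing `σ` with its relabelling on the component (`abs_density_flip_le`, `mean_mul_centred_le`).

The exceptional events are cheap. Counting paths bounds the expected component size by `1 / (1 -
d)`, where `d < 1` enters (`mean_card_comp_le`). This handles large components as well as pairs in
the same component. Small components with a cycle have probability `O(1/n)` (`mean_cyclic_comp_le`),
and atypical label counts are excluded by a variance bound (`mean_sq_sum_centred_le`).

The eigenvalue claim holds because `T` is the identity matrix, and non-reconstructability follows
from uniqueness of limits. -/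

lemma sum_graph_prod (a b : Fin n × Fin n → ℝ) :
    ∑ G : SimpleGraph (Fin n), ∏ e : Fin n × Fin n with e.1 < e.2,
      (if G.Adj e.1 e.2 then a e else b e) = ∏ e : Fin n × Fin n with e.1 < e.2, (a e + b e) := by
  -- Expanding the product gives a sum over sets of ordered pairs `u < v`; such sets are exactly the
  -- edge sets of graphs.
  rw [Finset.prod_add]
  refine Finset.sum_bij' (fun G _ => univ.filter fun e : Fin n × Fin n => e.1 < e.2 ∧ G.Adj e.1 e.2)
    (fun t _ => SimpleGraph.fromRel fun u v => (u, v) ∈ t) ?_ ?_ ?_ ?_ ?_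
  · intro G _
    simp only [mem_powerset]
    intro e he
    simp only [mem_filter, mem_univ, true_and] at he ⊢
    exact he.1
  · intros; simp
  · intro G _
    ext u v
    simp only [SimpleGraph.fromRel_adj, mem_filter, mem_univ, true_and]
    constructor
    · rintro ⟨_, h | h⟩
      · exact h.2
      · exact h.2.symm
    · intro h
      refine ⟨h.ne, ?_⟩
      rcases lt_or_gt_of_ne h.ne with h' | h'
      · exact Or.inl ⟨h', h⟩
      · exact Or.inr ⟨h', h.symm⟩
  · intro t ht
    rw [mem_powerset] at ht
    ext ⟨u, v⟩
    simp only [SimpleGraph.fromRel_adj, mem_filter, mem_univ, true_and]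
    constructor
    · rintro ⟨h, _, h' | h'⟩
      · exact h'
      · have := ht h'
        simp only [mem_filter, mem_univ, true_and] at this
        exact absurd h this.not_gt
    · intro h
      have := ht h
      simp only [mem_filter, mem_univ, true_and] at this
      exact ⟨this, this.ne, Or.inl h⟩
  · intro G _
    rw [Finset.prod_ite]
    congr 1
    · refine Finset.prod_congr ?_ fun _ _ => rfl
      ext e; simp
    · refine Finset.prod_congr ?_ fun _ _ => rfl
      ext e
      simp only [mem_filter, Finset.mem_sdiff, mem_univ, true_and, not_and]
      tauto

/-- The expectation of `f (G, σ)` for `(G, σ) ∼ 𝒢(n, M/n, π)`. -/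
noncomputable def mean (n : ℕ) (M : Matrix (Fin s) (Fin s) ℝ) (π : Fin s → ℝ)
    (f : SimpleGraph (Fin n) → (Fin n → Fin s) → ℝ) : ℝ :=
  ∑ G : SimpleGraph (Fin n), ∑ σ : Fin n → Fin s, density n M π G σ * f G σ

variable {M : Matrix (Fin s) (Fin s) ℝ} {π : Fin s → ℝ}

/-- The indicator can be absorbed into the density by replacing the non-edge factor of each pair in
`F` by `0`. The sum over graphs then factorises, and each pair outside `F` contributes total mass
`1`. -/
lemma sum_density_of_subset (σ : Fin n → Fin s) (F : Finset (Fin n × Fin n))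
    (hF : ∀ e ∈ F, e.1 < e.2) :
    ∑ G : SimpleGraph (Fin n), density n M π G σ * (if ∀ e ∈ F, G.Adj e.1 e.2 then 1 else 0) =
      (∏ v, π (σ v)) * ∏ e ∈ F, M (σ e.1) (σ e.2) / n := by
  have key : ∀ G : SimpleGraph (Fin n),
      density n M π G σ * (if ∀ e ∈ F, G.Adj e.1 e.2 then 1 else 0) =
      (∏ v, π (σ v)) * ∏ e : Fin n × Fin n with e.1 < e.2,
        (if G.Adj e.1 e.2 then M (σ e.1) (σ e.2) / n else
          if e ∈ F then 0 else 1 - M (σ e.1) (σ e.2) / n) := by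
    intro G
    unfold density
    split_ifs with h
    · rw [mul_one]
      congr 1
      refine Finset.prod_congr rfl fun e _ => ?_
      by_cases h1 : G.Adj e.1 e.2
      · simp [h1]
      · have : e ∉ F := fun h2 => h1 (h e h2)
        simp [h1, this]
    · push Not at h
      obtain ⟨e, he, hne⟩ := h
      rw [mul_zero, eq_comm]
      refine mul_eq_zero_of_right _ (Finset.prod_eq_zero (i := e) ?_ ?_)
      · simp [hF e he]
      · simp [hne, he]
  rw [Finset.sum_congr rfl fun G _ => key G, ← Finset.mul_sum, sum_graph_prod]
  congr 1
  have h2 : F = (univ.filter fun e : Fin n × Fin n => e.1 < e.2).filter fun e => e ∈ F := by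
    ext e
    simp only [mem_filter, mem_univ, true_and]
    exact ⟨fun h => ⟨hF e h, h⟩, fun h => h.2⟩
  conv_rhs => rw [h2]
  rw [Finset.prod_filter (p := fun e => e ∈ F)]
  refine Finset.prod_congr rfl fun e _ => ?_
  split_ifs <;> ring

lemma mean_comm (f : SimpleGraph (Fin n) → (Fin n → Fin s) → ℝ) :
    mean n M π f = ∑ σ, ∑ G, density n M π G σ * f G σ :=
  Finset.sum_comm

lemma mean_of_labels (h : (Fin n → Fin s) → ℝ) :
    mean n M π (fun _ σ => h σ) = ∑ σ, (∏ v, π (σ v)) * h σ := by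
  rw [mean_comm]
  refine Finset.sum_congr rfl fun σ _ => ?_
  have := sum_density_of_subset (M := M) (π := π) σ ∅ (by simp)
  simp only [notMem_empty, false_imp_iff, implies_true, if_true, mul_one, prod_empty] at this
  rw [← Finset.sum_mul, this]

lemma sum_prod_label (f : Fin n → Fin s → ℝ) :
    ∑ σ : Fin n → Fin s, ∏ v, f v (σ v) = ∏ v, ∑ i, f v i := by
  rw [Finset.prod_univ_sum, Fintype.piFinset_univ]

lemma mean_mono_subset (hπ : ∑ i, π i = 1) (S : Finset (Fin n)) (F : Finset (Fin n × Fin n))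
    (hF : ∀ e ∈ F, e.1 < e.2) (hFS : ∀ e ∈ F, e.1 ∈ S ∧ e.2 ∈ S) (i : Fin s) :
    mean n M π (fun G σ => (if ∀ e ∈ F, G.Adj e.1 e.2 then 1 else 0) *
      (if ∀ v ∈ S, σ v = i then 1 else 0)) = π i ^ S.card * (M i i / n) ^ F.card := by
  rw [mean_comm]
  have key : ∀ σ : Fin n → Fin s, ∑ G : SimpleGraph (Fin n), density n M π G σ *
      ((if ∀ e ∈ F, G.Adj e.1 e.2 then 1 else 0) * (if ∀ v ∈ S, σ v = i then 1 else 0)) =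
      (∏ v, π (σ v) * if v ∈ S then (if σ v = i then 1 else 0) else 1) * (M i i / n) ^ F.card := by
    intro σ
    simp only [← mul_assoc]
    rw [← Finset.sum_mul, sum_density_of_subset σ F hF, Finset.prod_mul_distrib]
    split_ifs with h
    · have h1 : ∏ e ∈ F, M (σ e.1) (σ e.2) / n = (M i i / n) ^ F.card := by
        rw [← Finset.prod_const]
        refine Finset.prod_congr rfl fun e he => ?_
        rw [h _ (hFS e he).1, h _ (hFS e he).2]
      have h2 : (∏ v, if v ∈ S then (if σ v = i then (1 : ℝ) else 0) else 1) = 1 := by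
        refine Finset.prod_eq_one fun v _ => ?_
        split_ifs with h3 h4
        · rfl
        · exact absurd (h v h3) h4
        · rfl
      rw [h1, h2]; ring
    · push Not at h
      obtain ⟨v, hv, hne⟩ := h
      have h2 : (∏ v, if v ∈ S then (if σ v = i then (1 : ℝ) else 0) else 1) = 0 :=
        Finset.prod_eq_zero (i := v) (mem_univ v) (by simp [hv, hne])
      rw [h2]; ring
  rw [Finset.sum_congr rfl fun σ _ => key σ, ← Finset.sum_mul,
    sum_prod_label (fun v j => π j * if v ∈ S then (if j = i then 1 else 0) else 1)]
  congr 1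
  rw [← Finset.prod_const, ← Finset.prod_filter_mul_prod_filter_not univ (fun v => v ∈ S)]
  have h1 : ∏ v with v ∉ S, (∑ j, π j * if v ∈ S then (if j = i then (1 : ℝ) else 0) else 1) = 1 :=
    Finset.prod_eq_one fun v hv => by
      simp only [mem_filter, mem_univ, true_and] at hv
      simp [hv, hπ]
  rw [h1, mul_one]
  refine Finset.prod_congr (by ext; simp) fun v hv => ?_
  simp [hv]

lemma density_nonneg (hπ : ∀ i, 0 ≤ π i) (hM : ∀ i j, 0 ≤ M i j) (hn : ∀ i j, M i j ≤ n)
    (G : SimpleGraph (Fin n)) (σ : Fin n → Fin s) : 0 ≤ density n M π G σ := by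
  unfold density
  refine mul_nonneg (Finset.prod_nonneg fun v _ => hπ _) (Finset.prod_nonneg fun e _ => ?_)
  split_ifs
  · exact div_nonneg (hM _ _) (Nat.cast_nonneg n)
  · rw [sub_nonneg]
    exact div_le_one_of_le₀ (hn _ _) (Nat.cast_nonneg n)

lemma mean_add (f g : SimpleGraph (Fin n) → (Fin n → Fin s) → ℝ) :
    mean n M π (fun G σ => f G σ + g G σ) = mean n M π f + mean n M π g := by
  simp only [mean, mul_add, Finset.sum_add_distrib]

lemma mean_const_mul (c : ℝ) (f : SimpleGraph (Fin n) → (Fin n → Fin s) → ℝ) :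
    mean n M π (fun G σ => c * f G σ) = c * mean n M π f := by
  simp only [mean, Finset.mul_sum]
  exact Finset.sum_congr rfl fun _ _ => Finset.sum_congr rfl fun _ _ => by ring

lemma mean_sum {ι : Type*} (t : Finset ι)
    (f : ι → SimpleGraph (Fin n) → (Fin n → Fin s) → ℝ) :
    mean n M π (fun G σ => ∑ i ∈ t, f i G σ) = ∑ i ∈ t, mean n M π (f i) := by
  simp only [mean, Finset.mul_sum]
  rw [Finset.sum_congr rfl fun G _ => Finset.sum_comm, Finset.sum_comm]

/-- Monotonicity, with the comparison needed only where the density does not vanish. -/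
lemma mean_le_mean (h0 : ∀ G σ, 0 ≤ density n M π G σ)
    {f g : SimpleGraph (Fin n) → (Fin n → Fin s) → ℝ}
    (h : ∀ G σ, density n M π G σ ≠ 0 → f G σ ≤ g G σ) : mean n M π f ≤ mean n M π g := by
  refine Finset.sum_le_sum fun G _ => Finset.sum_le_sum fun σ _ => ?_
  by_cases hd : density n M π G σ = 0
  · simp [hd]
  · exact mul_le_mul_of_nonneg_left (h G σ hd) (h0 G σ)

lemma mean_const (hπ : ∑ i, π i = 1) (c : ℝ) : mean n M π (fun _ _ => c) = c := by
  rw [mean_of_labels, ← Finset.sum_mul, sum_prod_label (fun _ i => π i)]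
  simp [hπ]

/-- An edge between different labels contributes a factor `0`, so a nonvanishing density forces
labels to agree along every walk. -/
lemma label_eq_of_reachable (hM : ∀ i j, i ≠ j → M i j = 0) {G : SimpleGraph (Fin n)}
    {σ : Fin n → Fin s} (hd : density n M π G σ ≠ 0) {u v : Fin n} (h : G.Reachable u v) :
    σ u = σ v := by
  have hlt : ∀ a b, a < b → G.Adj a b → σ a = σ b := by
    intro a b hab hadj
    by_contra hne
    apply hd
    unfold density
    refine mul_eq_zero_of_right _ (Finset.prod_eq_zero (i := (a, b)) (by simp [hab]) ?_)
    simp [hadj, hM _ _ hne]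
  have hadj : ∀ a b, G.Adj a b → σ a = σ b := by
    intro a b h
    rcases lt_or_gt_of_ne h.ne with h' | h'
    · exact hlt a b h' h
    · exact (hlt b a h' h.symm).symm
  obtain ⟨w⟩ := h
  induction w with
  | nil => rfl
  | cons h _ ih => exact (hadj _ _ h).trans ih

end Moments

/-! ### Component sizes and short cycles in the subcritical regime -/

section Components

open scoped Classical
open Finset

variable {s n : ℕ} {M : Matrix (Fin s) (Fin s) ℝ} {π : Fin s → ℝ} {d : ℝ}

/-- The vertex set of the component of `u`. -/
noncomputable def comp (G : SimpleGraph (Fin n)) (u : Fin n) : Finset (Fin n) :=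
  univ.filter fun v => G.Reachable u v

/-- The edges of the component of `u`, as ordered pairs `a < b`. -/
noncomputable def compEdges (G : SimpleGraph (Fin n)) (u : Fin n) : Finset (Fin n × Fin n) :=
  univ.filter fun e => e.1 < e.2 ∧ G.Adj e.1 e.2 ∧ e.1 ∈ comp G u

/-- The event that `G` contains all pairs in `F` and that all labels on `S` equal `i`. -/
noncomputable def monoIndicator (S : Finset (Fin n)) (F : Finset (Fin n × Fin n)) (i : Fin s)
    (G : SimpleGraph (Fin n)) (σ : Fin n → Fin s) : ℝ :=
  (if ∀ e ∈ F, G.Adj e.1 e.2 then 1 else 0) * (if ∀ v ∈ S, σ v = i then 1 else 0)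

lemma monoIndicator_nonneg (S : Finset (Fin n)) (F : Finset (Fin n × Fin n)) (i : Fin s)
    (G : SimpleGraph (Fin n)) (σ : Fin n → Fin s) : 0 ≤ monoIndicator S F i G σ := by
  unfold monoIndicator
  positivity

lemma one_le_sum_monoIndicator {S : Finset (Fin n)} {F : Finset (Fin n × Fin n)} {i : Fin s}
    {G : SimpleGraph (Fin n)} {σ : Fin n → Fin s} (hF : ∀ e ∈ F, G.Adj e.1 e.2)
    (hS : ∀ v ∈ S, σ v = i) : 1 ≤ ∑ j, monoIndicator S F j G σ := by
  have h1 : monoIndicator S F i G σ = 1 := by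
    unfold monoIndicator
    rw [if_pos hF, if_pos hS, mul_one]
  rw [← h1]
  exact Finset.single_le_sum (f := fun j => monoIndicator S F j G σ)
    (fun j _ => monoIndicator_nonneg S F j G σ) (mem_univ i)

lemma mem_comp {G : SimpleGraph (Fin n)} {u v : Fin n} : v ∈ comp G u ↔ G.Reachable u v := by
  simp [comp]

lemma self_mem_comp (G : SimpleGraph (Fin n)) (u : Fin n) : u ∈ comp G u :=
  mem_comp.2 (SimpleGraph.Reachable.refl u)

lemma mean_monoIndicator (hπ : ∑ i, π i = 1) (S : Finset (Fin n)) (F : Finset (Fin n × Fin n))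
    (hF : ∀ e ∈ F, e.1 < e.2) (hFS : ∀ e ∈ F, e.1 ∈ S ∧ e.2 ∈ S) (i : Fin s) :
    mean n M π (monoIndicator S F i) = π i ^ S.card * (M i i / n) ^ F.card :=
  mean_mono_subset hπ S F hF hFS i

/-- Tree-like counting: each edge cancels one factor `π i`, and the single surplus vertex leaves
weights that sum to `1`. -/
lemma sum_mean_of_card_eq_succ (hπ0 : ∀ i, 0 < π i) (hπ : ∑ i, π i = 1)
    (hM : ∀ i, M i i = d / π i) (S : Finset (Fin n)) (F : Finset (Fin n × Fin n))
    (hF : ∀ e ∈ F, e.1 < e.2) (hFS : ∀ e ∈ F, e.1 ∈ S ∧ e.2 ∈ S) (hc : S.card = F.card + 1) :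
    ∑ i, mean n M π (monoIndicator S F i) = (d / n) ^ F.card := by
  rw [← one_mul ((d / n) ^ F.card), ← hπ, Finset.sum_mul]
  refine Finset.sum_congr rfl fun i _ => ?_
  rw [mean_monoIndicator hπ S F hF hFS, hc, hM, pow_succ', mul_assoc, ← mul_pow]
  have := (hπ0 i).ne'
  congr 2
  field_simp

/-- With as many edges as vertices the powers of `π i` cancel completely, so each of the `s` labels
contributes equally. -/
lemma sum_mean_of_card_eq (hπ0 : ∀ i, 0 < π i) (hπ : ∑ i, π i = 1)
    (hM : ∀ i, M i i = d / π i) (S : Finset (Fin n)) (F : Finset (Fin n × Fin n))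
    (hF : ∀ e ∈ F, e.1 < e.2) (hFS : ∀ e ∈ F, e.1 ∈ S ∧ e.2 ∈ S) (hc : S.card = F.card) :
    ∑ i, mean n M π (monoIndicator S F i) = s * (d / n) ^ F.card := by
  have : ∀ i, mean n M π (monoIndicator S F i) = (d / n) ^ F.card := by
    intro i
    rw [mean_monoIndicator hπ S F hF hFS, hc, hM, ← mul_pow]
    have := (hπ0 i).ne'
    congr 1
    field_simp
  simp [this]

/-- The edges of a path, as ordered pairs. -/
noncomputable def pathEdges {k : ℕ} (w : Fin (k + 1) → Fin n) : Finset (Fin n × Fin n) :=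
  univ.image fun j : Fin k =>
    (min (w j.castSucc) (w j.succ), max (w j.castSucc) (w j.succ))

lemma card_pathEdges {k : ℕ} {w : Fin (k + 1) → Fin n} (hw : Function.Injective w) :
    (pathEdges w).card = k := by
  unfold pathEdges
  rw [Finset.card_image_of_injective, card_univ, Fintype.card_fin]
  intro i j hij
  simp only [Prod.mk.injEq] at hij
  have h : (w i.castSucc = w j.castSucc ∧ w i.succ = w j.succ) ∨
      (w i.castSucc = w j.succ ∧ w i.succ = w j.castSucc) := by
    rcases le_total (w i.castSucc) (w i.succ) with h1 | h1 <;>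
    rcases le_total (w j.castSucc) (w j.succ) with h2 | h2 <;>
    simp only [h1, h2, min_eq_left, min_eq_right, max_eq_left, max_eq_right] at hij <;> tauto
  rcases h with ⟨h, _⟩ | ⟨h1, h2⟩
  · exact Fin.castSucc_injective _ (hw h)
  · have h1 := congrArg Fin.val (hw h1)
    have h2 := congrArg Fin.val (hw h2)
    simp at h1 h2
    omega

lemma lt_of_mem_pathEdges {k : ℕ} {w : Fin (k + 1) → Fin n} (hw : Function.Injective w)
    {e : Fin n × Fin n} (he : e ∈ pathEdges w) : e.1 < e.2 := by
  simp only [pathEdges, mem_image, mem_univ, true_and] at he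
  obtain ⟨j, rfl⟩ := he
  have : w j.castSucc ≠ w j.succ := fun h => by simpa [Fin.ext_iff] using hw h
  simpa using this.symm

lemma mem_of_mem_pathEdges {k : ℕ} {w : Fin (k + 1) → Fin n}
    {e : Fin n × Fin n} (he : e ∈ pathEdges w) : e.1 ∈ univ.image w ∧ e.2 ∈ univ.image w := by
  simp only [pathEdges, mem_image, mem_univ, true_and] at he ⊢
  obtain ⟨j, rfl⟩ := he
  constructor
  · rcases min_choice (w j.castSucc) (w j.succ) with h | h <;> exact ⟨_, h.symm⟩
  · rcases max_choice (w j.castSucc) (w j.succ) with h | h <;> exact ⟨_, h.symm⟩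

lemma adj_of_mem_pathEdges {G : SimpleGraph (Fin n)} {k : ℕ} {w : Fin (k + 1) → Fin n}
    (hw : ∀ j : Fin k, G.Adj (w j.castSucc) (w j.succ))
    {e : Fin n × Fin n} (he : e ∈ pathEdges w) : G.Adj e.1 e.2 := by
  simp only [pathEdges, mem_image, mem_univ, true_and] at he
  obtain ⟨j, rfl⟩ := he
  rcases le_total (w j.castSucc) (w j.succ) with h | h
  · simpa [h] using hw j
  · simpa [h] using (hw j).symm

/-- Separating the fixed start `u` from the `k` free vertices `w` makes the number of candidate
paths of length `k` visibly `n ^ k`. -/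
lemma exists_path_of_reachable {G : SimpleGraph (Fin n)} {u v : Fin n} (h : G.Reachable u v) :
    ∃ k < n, ∃ w : Fin k → Fin n, Function.Injective (Fin.cons u w : Fin (k + 1) → Fin n) ∧
      (∀ j : Fin k, G.Adj ((Fin.cons u w : Fin (k + 1) → Fin n) j.castSucc)
        ((Fin.cons u w : Fin (k + 1) → Fin n) j.succ)) ∧
      (Fin.cons u w : Fin (k + 1) → Fin n) (Fin.last k) = v := by
  obtain ⟨p, hp⟩ := h.exists_isPath
  have hc : (Fin.cons u (fun j : Fin p.length => p.getVert (j + 1)) : Fin (p.length + 1) → Fin n) =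
      fun j : Fin (p.length + 1) => p.getVert j := by
    ext j
    refine Fin.cases ?_ (fun j => ?_) j <;> simp
  refine ⟨p.length, by simpa using hp.length_lt, fun j => p.getVert (j + 1), ?_, ?_, ?_⟩
  · rw [hc]
    intro i j hij
    exact Fin.ext (hp.getVert_injOn (by simpa using Fin.is_le i) (by simpa using Fin.is_le j) hij)
  · rw [hc]
    intro j
    simpa using p.adj_getVert_succ j.2
  · rw [hc]
    simp

lemma card_comp_le {G : SimpleGraph (Fin n)} {σ : Fin n → Fin s} (u : Fin n)
    (hσ : ∀ v ∈ comp G u, σ v = σ u) :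
    ((comp G u).card : ℝ) ≤ ∑ k ∈ range n, ∑ w : Fin k → Fin n,
      (if Function.Injective (Fin.cons u w : Fin (k + 1) → Fin n) then 1 else 0) *
        ∑ i, monoIndicator (univ.image (Fin.cons u w : Fin (k + 1) → Fin n))
          (pathEdges (Fin.cons u w : Fin (k + 1) → Fin n)) i G σ := by
  let P : (k : ℕ) → Finset (Fin k → Fin n) := fun k => univ.filter fun w =>
    Function.Injective (Fin.cons u w : Fin (k + 1) → Fin n) ∧
      ∀ j : Fin k, G.Adj ((Fin.cons u w : Fin (k + 1) → Fin n) j.castSucc)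
        ((Fin.cons u w : Fin (k + 1) → Fin n) j.succ)
  have h1 : comp G u ⊆ (range n).biUnion fun k =>
      (P k).image fun w => (Fin.cons u w : Fin (k + 1) → Fin n) (Fin.last k) := by
    intro v hv
    obtain ⟨k, hk, w, hw1, hw2, hw3⟩ := exists_path_of_reachable (mem_comp.1 hv)
    simp only [mem_biUnion, mem_image, mem_range]
    exact ⟨k, hk, w, mem_filter.2 ⟨mem_univ _, hw1, hw2⟩, hw3⟩
  have h2 : (comp G u).card ≤ ∑ k ∈ range n, (P k).card :=
    (card_le_card h1).trans (card_biUnion_le.trans (Finset.sum_le_sum fun k _ => card_image_le))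
  refine (Nat.cast_le.2 h2).trans ?_
  rw [Nat.cast_sum]
  refine Finset.sum_le_sum fun k _ => ?_
  rw [Finset.card_filter, Nat.cast_sum]
  refine Finset.sum_le_sum fun w _ => ?_
  split_ifs with h3 h4 h4
  · rw [Nat.cast_one, one_mul]
    refine one_le_sum_monoIndicator (i := σ u) (fun e he => adj_of_mem_pathEdges h3.2 he) ?_
    intro v hv
    simp only [mem_image, mem_univ, true_and] at hv
    obtain ⟨j, rfl⟩ := hv
    refine hσ _ (mem_comp.2 ?_)
    induction j using Fin.induction with
    | zero => exact SimpleGraph.Reachable.refl u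
    | succ j ih => exact ih.trans (h3.2 j).reachable
  · exact absurd h3.1 h4
  · rw [Nat.cast_zero, one_mul]
    exact Finset.sum_nonneg fun i _ => monoIndicator_nonneg _ _ _ _ _
  · simp

lemma label_eq_on_comp (hM0 : ∀ i j, i ≠ j → M i j = 0) {G : SimpleGraph (Fin n)}
    {σ : Fin n → Fin s} (hd : density n M π G σ ≠ 0) (u : Fin n) :
    ∀ v ∈ comp G u, σ v = σ u :=
  fun _ hv => (label_eq_of_reachable hM0 hd (mem_comp.1 hv)).symm

/-- In the subcritical regime the expected size of a component is bounded. -/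
lemma mean_card_comp_le (hπ0 : ∀ i, 0 < π i) (hπ : ∑ i, π i = 1)
    (hM : ∀ i, M i i = d / π i) (hM0 : ∀ i j, i ≠ j → M i j = 0) (hd0 : 0 ≤ d) (hd1 : d < 1)
    (hD : ∀ G σ, 0 ≤ density n M π G σ) (u : Fin n) :
    mean n M π (fun G _ => ((comp G u).card : ℝ)) ≤ 1 / (1 - d) := by
  refine (mean_le_mean hD fun G σ hne => card_comp_le (σ := σ) u
    (label_eq_on_comp hM0 hne u)).trans ?_
  have hn : (n : ℝ) ≠ 0 := by
    have := u.pos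
    positivity
  rw [mean_sum]
  -- There are `n ^ k` choices of path and each is present with probability at most `(d / n) ^ k`.
  calc _ ≤ ∑ k ∈ range n, d ^ k := by
        refine Finset.sum_le_sum fun k _ => ?_
        rw [mean_sum]
        calc _ ≤ ∑ w : Fin k → Fin n, (d / n) ^ k := by
              refine Finset.sum_le_sum fun w _ => ?_
              rw [mean_const_mul, mean_sum]
              split_ifs with hw
              · rw [sum_mean_of_card_eq_succ hπ0 hπ hM _ _ (fun e he => lt_of_mem_pathEdges hw he)
                  (fun e he => mem_of_mem_pathEdges he), card_pathEdges hw, one_mul]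
                rw [card_pathEdges hw, card_image_of_injective _ hw]
                simp
              · rw [zero_mul]
                positivity
          _ = d ^ k := by
              simp only [sum_const, card_univ, Fintype.card_pi, Fintype.card_fin, prod_const,
                nsmul_eq_mul, Nat.cast_pow]
              rw [← mul_pow, mul_div_cancel₀ _ hn]
    _ ≤ ∑' k, d ^ k := (summable_geometric_of_lt_one hd0 hd1).sum_le_tsum _
        (fun k _ => pow_nonneg hd0 k)
    _ = 1 / (1 - d) := by rw [tsum_geometric_of_lt_one hd0 hd1, one_div]

lemma compEdges_subset (G : SimpleGraph (Fin n)) (u : Fin n) :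
    compEdges G u ⊆ (comp G u ×ˢ comp G u).filter fun e => e.1 < e.2 := by
  intro e he
  simp only [compEdges, mem_filter, mem_univ, true_and, mem_product] at he ⊢
  exact ⟨⟨he.2.2, mem_comp.2 ((mem_comp.1 he.2.2).trans he.2.1.reachable)⟩, he.1⟩

/-- The probability that `u` lies in a small component containing a cycle is `O(1/n)`. -/
lemma mean_cyclic_comp_le (hπ0 : ∀ i, 0 < π i) (hπ : ∑ i, π i = 1)
    (hM : ∀ i, M i i = d / π i) (hM0 : ∀ i j, i ≠ j → M i j = 0) (hd0 : 0 ≤ d) (hd1 : d < 1)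
    (hD : ∀ G σ, 0 ≤ density n M π G σ) (u : Fin n) (K : ℕ) :
    mean n M π (fun G _ => if (comp G u).card ≤ K ∧ (comp G u).card ≤ (compEdges G u).card
      then 1 else 0) ≤ (∑ k ∈ range K, (2 : ℝ) ^ ((k + 1) * (k + 1)) * s) / n := by
  let Q : Finset (Fin n) → Finset (Fin n × Fin n) := fun S => (S ×ˢ S).filter fun e => e.1 < e.2
  have hn : (n : ℝ) ≠ 0 := by
    have := u.pos
    positivity
  have hle : mean n M π (fun G _ => if (comp G u).card ≤ K ∧
      (comp G u).card ≤ (compEdges G u).card then 1 else 0) ≤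
      mean n M π (fun G σ => ∑ k ∈ range K, ∑ S ∈ powersetCard k (univ.erase u),
        ∑ F ∈ powersetCard (k + 1) (Q (insert u S)), ∑ i, monoIndicator (insert u S) F i G σ) := by
    refine mean_le_mean hD fun G σ hne => ?_
    have h0 : ∀ S F, 0 ≤ ∑ i, monoIndicator (insert u S) F i G σ := fun S F =>
      Finset.sum_nonneg fun i _ => monoIndicator_nonneg _ _ _ _ _
    split_ifs with h
    · obtain ⟨hK, hE⟩ := h
      have hu := self_mem_comp G u
      have hpos : 0 < (comp G u).card := card_pos.2 ⟨u, hu⟩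
      -- Keep exactly as many edges as vertices. The union bound runs over the `k` vertices other
      -- than `u`, with `k + 1` edges among the `k + 1` vertices.
      obtain ⟨F, hF, hFc⟩ := exists_subset_card_eq hE
      have hins : insert u ((comp G u).erase u) = comp G u := insert_erase hu
      have h1 : 1 ≤ ∑ i, monoIndicator (insert u ((comp G u).erase u)) F i G σ := by
        refine one_le_sum_monoIndicator (i := σ u) (fun e he => ?_) ?_
        · have := hF he
          simp only [compEdges, mem_filter] at this
          exact this.2.2.1
        · rw [hins]
          exact label_eq_on_comp hM0 hne u
      refine h1.trans ?_
      refine le_trans ?_ (Finset.single_le_sum (f := fun k => ∑ S ∈ powersetCard k (univ.erase u),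
        ∑ F ∈ powersetCard (k + 1) (Q (insert u S)), ∑ i, monoIndicator (insert u S) F i G σ)
        (fun k _ => Finset.sum_nonneg fun S _ => Finset.sum_nonneg fun F _ => h0 S F)
        (mem_range.2 (show (comp G u).card - 1 < K by omega)))
      refine le_trans ?_ (Finset.single_le_sum (a := (comp G u).erase u) (f := fun S =>
        ∑ F ∈ powersetCard ((comp G u).card - 1 + 1) (Q (insert u S)),
          ∑ i, monoIndicator (insert u S) F i G σ)
        (fun S _ => Finset.sum_nonneg fun F _ => h0 S F) ?_)
      · refine Finset.single_le_sum (f := fun F =>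
          ∑ i, monoIndicator (insert u ((comp G u).erase u)) F i G σ) (fun F _ => h0 _ F) ?_
        rw [mem_powersetCard, hins]
        exact ⟨hF.trans (compEdges_subset G u), by omega⟩
      · rw [mem_powersetCard]
        exact ⟨erase_subset_erase _ (subset_univ _), card_erase_of_mem hu⟩
    · exact Finset.sum_nonneg fun k _ => Finset.sum_nonneg fun S _ =>
        Finset.sum_nonneg fun F _ => h0 S F
  refine hle.trans ?_
  rw [mean_sum, Finset.sum_div]
  refine Finset.sum_le_sum fun k _ => ?_
  rw [mean_sum]
  calc _ ≤ ∑ S ∈ powersetCard k (univ.erase u), (2 : ℝ) ^ ((k + 1) * (k + 1)) *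
        (s * (d / n) ^ (k + 1)) := by
        refine Finset.sum_le_sum fun S hS => ?_
        rw [mem_powersetCard] at hS
        have huS : u ∉ S := fun h => by simpa using hS.1 h
        have hc : (insert u S).card = k + 1 := by rw [card_insert_of_notMem huS, hS.2]
        rw [mean_sum]
        calc _ = ∑ F ∈ powersetCard (k + 1) (Q (insert u S)), (s : ℝ) * (d / n) ^ (k + 1) := by
              refine Finset.sum_congr rfl fun F hF => ?_
              rw [mem_powersetCard] at hF
              rw [mean_sum, sum_mean_of_card_eq hπ0 hπ hM, hF.2]
              · intro e he
                have := hF.1 he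
                simp only [Q, mem_filter] at this
                exact this.2
              · intro e he
                have := hF.1 he
                simp only [Q, mem_filter, mem_product] at this
                exact this.1
              · rw [hc, hF.2]
          _ ≤ _ := by
              rw [sum_const, nsmul_eq_mul]
              gcongr
              rw [card_powersetCard]
              have h1 : (Q (insert u S)).card ≤ (k + 1) * (k + 1) := by
                refine (card_filter_le _ _).trans ?_
                rw [card_product, hc]
              have h2 := (Nat.choose_le_two_pow (Q (insert u S)).card (k + 1)).trans
                (Nat.pow_le_pow_right (by norm_num) h1)
              exact_mod_cast h2
    _ ≤ _ := by
        rw [sum_const, nsmul_eq_mul, card_powersetCard]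
        have h1 : (((univ.erase u).card.choose k : ℕ) : ℝ) ≤ (n : ℝ) ^ k := by
          have : (univ.erase u).card ≤ n := by simp
          exact_mod_cast (Nat.choose_le_pow _ _).trans (Nat.pow_le_pow_left this k)
        -- Only `k` vertices are free against `k + 1` edges, so one factor `1 / n` survives.
        calc _ ≤ (n : ℝ) ^ k * (2 ^ ((k + 1) * (k + 1)) * (s * (d / n) ^ (k + 1))) := by gcongr
          _ = 2 ^ ((k + 1) * (k + 1)) * s * d ^ (k + 1) / n := by
              rw [div_pow]
              field_simp
              ring
          _ ≤ _ := div_le_div_of_nonneg_right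
              (mul_le_of_le_one_right (by positivity) (pow_le_one₀ hd0 hd1.le)) (by positivity)

end Components

/-! ### The density as a function of the label of a tree component -/

section Flip

open scoped Classical
open Finset

variable {s n : ℕ} {M : Matrix (Fin s) (Fin s) ℝ} {π : Fin s → ℝ} {d : ℝ}

lemma card_comp_le_card_compEdges_add_one (G : SimpleGraph (Fin n)) (u : Fin n) :
    (comp G u).card ≤ (compEdges G u).card + 1 := by
  set C := G.connectedComponentMk u with hC
  have h1 := C.connected_toSimpleGraph.card_vert_le_card_edgeSet_add_one
  have hmem : ∀ v, v ∈ C ↔ v ∈ comp G u := fun v => by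
    rw [mem_comp, hC]
    exact SimpleGraph.ConnectedComponent.eq.trans SimpleGraph.reachable_comm
  have h2 : Nat.card C = (comp G u).card := by
    rw [← Nat.card_eq_finsetCard]
    exact Nat.card_congr (Equiv.subtypeEquivRight hmem)
  rw [← h2]
  refine h1.trans (Nat.add_le_add_right ?_ 1)
  rw [← Nat.card_eq_finsetCard]
  refine Nat.card_le_card_of_surjective (fun e : compEdges G u => ?_) ?_
  · have he : e.1.1 < e.1.2 ∧ G.Adj e.1.1 e.1.2 ∧ e.1.1 ∈ comp G u := by
      simpa [compEdges] using e.2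
    have he2 : e.1.2 ∈ comp G u := mem_comp.2 ((mem_comp.1 he.2.2).trans he.2.1.reachable)
    exact ⟨s(⟨e.1.1, (hmem _).2 he.2.2⟩, ⟨e.1.2, (hmem _).2 he2⟩), he.2.1⟩
  · rintro ⟨z, hz⟩
    induction z using Sym2.ind with
    | _ a b =>
      have hab : G.Adj a.1 b.1 := hz
      rcases lt_or_gt_of_ne hab.ne with h | h
      · exact ⟨⟨(a.1, b.1), by simpa [compEdges, h, hab] using (hmem _).1 a.2⟩, rfl⟩
      · refine ⟨⟨(b.1, a.1), by simpa [compEdges, h, hab.symm] using (hmem _).1 b.2⟩, ?_⟩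
        exact Subtype.ext Sym2.eq_swap

/-- Symmetry of `φ` lets the pairs crossing between `S` and its complement be indexed without regard
to their order. -/
lemma prod_pairs_split (S : Finset (Fin n)) (φ : Fin n → Fin n → ℝ) (hφ : ∀ a b, φ a b = φ b a) :
    ∏ e : Fin n × Fin n with e.1 < e.2, φ e.1 e.2 =
      (∏ e ∈ (S ×ˢ S).filter fun e => e.1 < e.2, φ e.1 e.2) * (∏ a ∈ S, ∏ b ∈ Sᶜ, φ a b) *
        ∏ e ∈ (Sᶜ ×ˢ Sᶜ).filter fun e => e.1 < e.2, φ e.1 e.2 := by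
  have hcross : ∏ a ∈ S, ∏ b ∈ Sᶜ, φ a b =
      (∏ e ∈ (S ×ˢ Sᶜ).filter fun e => e.1 < e.2, φ e.1 e.2) *
        ∏ e ∈ (Sᶜ ×ˢ S).filter fun e => e.1 < e.2, φ e.1 e.2 := by
    rw [← Finset.prod_product', ← Finset.prod_filter_mul_prod_filter_not _ (fun e => e.1 < e.2)]
    congr 1
    refine Finset.prod_bij' (fun e _ => e.swap) (fun e _ => e.swap) ?_ ?_ ?_ ?_ ?_
    · rintro ⟨a, b⟩ h
      simp only [mem_filter, mem_product, mem_compl, not_lt, Prod.swap] at h ⊢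
      exact ⟨h.1.symm, lt_of_le_of_ne h.2 fun h' => h.1.2 (h' ▸ h.1.1)⟩
    · rintro ⟨a, b⟩ h
      simp only [mem_filter, mem_product, mem_compl, not_lt, Prod.swap] at h ⊢
      exact ⟨h.1.symm, h.2.le⟩
    · intros; rfl
    · intros; rfl
    · intro e _
      exact hφ _ _
  rw [hcross, ← Finset.prod_filter_mul_prod_filter_not (univ.filter fun e : Fin n × Fin n =>
    e.1 < e.2) (fun e => e.1 ∈ S),
    ← Finset.prod_filter_mul_prod_filter_not (filter (fun e => e.1 ∈ S)
      (univ.filter fun e : Fin n × Fin n => e.1 < e.2)) (fun e => e.2 ∈ S),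
    ← Finset.prod_filter_mul_prod_filter_not (filter (fun e => e.1 ∉ S)
      (univ.filter fun e : Fin n × Fin n => e.1 < e.2)) (fun e => e.2 ∈ S)]
  simp only [Finset.filter_filter]
  have e1 : ∀ A B : Finset (Fin n), (univ.filter fun e : Fin n × Fin n =>
      (e.1 < e.2 ∧ e.1 ∈ A) ∧ e.2 ∈ B) = (A ×ˢ B).filter fun e => e.1 < e.2 := by
    intro A B
    ext e
    simp only [mem_filter, mem_univ, true_and, mem_product]
    tauto
  have e2 := e1 S S
  have e3 := e1 S Sᶜ
  have e4 := e1 Sᶜ S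
  have e5 := e1 Sᶜ Sᶜ
  simp only [mem_compl] at e3 e4 e5
  rw [← e2, ← e3, ← e4, ← e5]
  ring

/-- The number of vertices labelled `i` outside the component of `u`. -/
noncomputable def outsideCount (G : SimpleGraph (Fin n)) (u : Fin n) (σ : Fin n → Fin s)
    (i : Fin s) : ℕ :=
  ((comp G u)ᶜ.filter fun v => σ v = i).card

/-- The non-edges inside the component of `u`. -/
noncomputable def compNonedges (G : SimpleGraph (Fin n)) (u : Fin n) : Finset (Fin n × Fin n) :=
  (comp G u ×ˢ comp G u).filter fun e => e.1 < e.2 ∧ ¬ G.Adj e.1 e.2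

/-- The factor of the density that comes from the vertices outside the component of `u`. -/
noncomputable def outsideDensity (n : ℕ) (M : Matrix (Fin s) (Fin s) ℝ) (π : Fin s → ℝ)
    (G : SimpleGraph (Fin n)) (u : Fin n) (σ : Fin n → Fin s) : ℝ :=
  (∏ v ∈ (comp G u)ᶜ, π (σ v)) * ∏ e ∈ ((comp G u)ᶜ ×ˢ (comp G u)ᶜ).filter fun e => e.1 < e.2,
    if G.Adj e.1 e.2 then M (σ e.1) (σ e.2) / n else 1 - M (σ e.1) (σ e.2) / n

/-- This isolates the dependence on `i`. In a tree the vertex and edge factors leave a single `π i`.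
Crossing pairs are non-edges and matter only when the outer vertex also has label `i`. -/
lemma density_eq_of_tree (hπ0 : ∀ i, 0 < π i) (hM : ∀ i, M i i = d / π i)
    (hM0 : ∀ i j, i ≠ j → M i j = 0) {G : SimpleGraph (Fin n)} {u : Fin n} {σ : Fin n → Fin s}
    {i : Fin s} (hσ : ∀ v ∈ comp G u, σ v = i)
    (htree : (comp G u).card = (compEdges G u).card + 1) :
    density n M π G σ = outsideDensity n M π G u σ * (d / n) ^ (compEdges G u).card * π i *
      (1 - d / π i / n) ^ ((compNonedges G u).card + (comp G u).card * outsideCount G u σ i) := by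
  have hsymm : ∀ i j, M i j = M j i := by
    intro i j
    by_cases h : i = j
    · rw [h]
    · rw [hM0 i j h, hM0 j i (Ne.symm h)]
  unfold density
  rw [prod_pairs_split (comp G u) (fun a b => if G.Adj a b then M (σ a) (σ b) / n
    else 1 - M (σ a) (σ b) / n) (fun a b => by rw [G.adj_comm, hsymm])]
  have h1 : ∏ v, π (σ v) = π i ^ (comp G u).card * ∏ v ∈ (comp G u)ᶜ, π (σ v) := by
    rw [← Finset.prod_mul_prod_compl (comp G u), ← Finset.prod_const]
    congr 1
    exact Finset.prod_congr rfl fun v hv => by rw [hσ v hv]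
  have h2 : (∏ e ∈ (comp G u ×ˢ comp G u).filter fun e => e.1 < e.2,
      if G.Adj e.1 e.2 then M (σ e.1) (σ e.2) / n else 1 - M (σ e.1) (σ e.2) / n) =
      (d / π i / n) ^ (compEdges G u).card * (1 - d / π i / n) ^ (compNonedges G u).card := by
    rw [Finset.prod_ite, ← Finset.prod_const, ← Finset.prod_const]
    congr 1
    · refine Finset.prod_congr ?_ fun e he => ?_
      · rw [Finset.filter_filter]
        ext e
        constructor
        · intro h
          simp only [mem_filter, mem_product, compEdges, mem_univ, true_and] at h ⊢
          tauto
        · intro h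
          have h' := compEdges_subset G u h
          simp only [mem_filter, mem_product, compEdges, mem_univ, true_and] at h h' ⊢
          tauto
      · have := compEdges_subset G u he
        simp only [mem_filter, mem_product] at this
        rw [hσ _ this.1.1, hσ _ this.1.2, hM]
    · refine Finset.prod_congr ?_ fun e he => ?_
      · rw [Finset.filter_filter]
        rfl
      · simp only [compNonedges, mem_filter, mem_product] at he
        rw [hσ _ he.1.1, hσ _ he.1.2, hM]
  have h3 : (∏ a ∈ comp G u, ∏ b ∈ (comp G u)ᶜ,
      if G.Adj a b then M (σ a) (σ b) / n else 1 - M (σ a) (σ b) / n) =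
      (1 - d / π i / n) ^ ((comp G u).card * outsideCount G u σ i) := by
    rw [mul_comm, pow_mul, ← Finset.prod_const]
    refine Finset.prod_congr rfl fun a ha => ?_
    rw [outsideCount, ← Finset.prod_const, Finset.prod_filter]
    refine Finset.prod_congr rfl fun b hb => ?_
    have hadj : ¬ G.Adj a b := fun h =>
      (mem_compl.1 hb) (mem_comp.2 ((mem_comp.1 ha).trans h.reachable))
    rw [if_neg hadj, hσ a ha]
    split_ifs with h
    · rw [h, hM]
    · rw [hM0 _ _ (Ne.symm h)]
      simp
  have h4 : π i ^ (comp G u).card * (d / π i / n) ^ (compEdges G u).card =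
      π i * (d / n) ^ (compEdges G u).card := by
    rw [htree, pow_succ', mul_assoc, ← mul_pow]
    have := (hπ0 i).ne'
    congr 2
    field_simp
  rw [h1, h2, h3, outsideDensity, pow_add]
  linear_combination ((∏ v ∈ (comp G u)ᶜ, π (σ v)) *
    (1 - d / π i / n) ^ (compNonedges G u).card *
    (1 - d / π i / n) ^ ((comp G u).card * outsideCount G u σ i) *
    ∏ e ∈ ((comp G u)ᶜ ×ˢ (comp G u)ᶜ).filter fun e => e.1 < e.2,
      if G.Adj e.1 e.2 then M (σ e.1) (σ e.2) / n else 1 - M (σ e.1) (σ e.2) / n) * h4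

lemma abs_exp_sub_exp_le (a b : ℝ) :
    |Real.exp a - Real.exp b| ≤ |a - b| * (Real.exp a + Real.exp b) := by
  wlog h : b ≤ a generalizing a b
  · rw [abs_sub_comm, abs_sub_comm a b, add_comm]
    exact this b a (le_of_not_ge h)
  have h1 : Real.exp b = Real.exp a * Real.exp (b - a) := by rw [← Real.exp_add]; congr 1; ring
  have h2 := Real.add_one_le_exp (b - a)
  rw [abs_of_nonneg (sub_nonneg.2 (Real.exp_le_exp.2 h)), abs_of_nonneg (sub_nonneg.2 h)]
  have := Real.exp_pos a
  have := Real.exp_pos b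
  nlinarith [mul_nonneg (sub_nonneg.2 h) (Real.exp_pos b).le]

lemma abs_log_one_sub_add_le {y : ℝ} (h0 : 0 ≤ y) (h1 : y ≤ 1 / 2) :
    |Real.log (1 - y) + y| ≤ 2 * y ^ 2 := by
  have h := Real.abs_log_sub_add_sum_range_le (x := y) (by rw [abs_of_nonneg h0]; linarith) 1
  simp only [range_one, sum_singleton, abs_of_nonneg h0] at h
  norm_num at h
  rw [add_comm]
  refine h.trans ?_
  rw [div_le_iff₀ (by linarith)]
  nlinarith [sq_nonneg y]

/-- To first order the exponent is `-k * (q * n) * (d / q) / n = -d * k`, in which the label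
probability `q` has disappeared. `X` bounds `d / q` uniformly over the labels. -/
lemma abs_exponent_le {d q X η N' : ℝ} {n K k m : ℕ} (hd0 : 0 ≤ d) (hq : 0 < q) (hn : 0 < n)
    (hX : d / q ≤ X) (hXn : 2 * X ≤ n) (hk : 1 ≤ k) (hkK : k ≤ K) (hm : m ≤ k * k)
    (hN0 : 0 ≤ N') (hNn : N' ≤ n) (hN : |N' - q * n| ≤ η * n) :
    |(m + k * N') * Real.log (1 - d / q / n) + d * k| ≤
      K * X * η + (K ^ 2 * X + 4 * K ^ 2 * X ^ 2) / n := by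
  have hn' : (0 : ℝ) < n := Nat.cast_pos.2 hn
  have hx0 : 0 ≤ d / q := div_nonneg hd0 hq.le
  set x := d / q with hx
  have hxq : d = x * q := by rw [hx]; field_simp
  have hkK' : (k : ℝ) ≤ K := Nat.cast_le.2 hkK
  have hk' : (1 : ℝ) ≤ k := by exact_mod_cast hk
  have hm' : (m : ℝ) ≤ (K : ℝ) ^ 2 := by
    calc (m : ℝ) ≤ k * k := by exact_mod_cast hm
      _ ≤ K * K := by gcongr
      _ = _ := by ring
  have hn1 : (1 : ℝ) ≤ n := by exact_mod_cast hn
  have hy : x / n ≤ 1 / 2 := by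
    rw [div_le_iff₀ hn']
    linarith
  have hlog := abs_log_one_sub_add_le (div_nonneg hx0 hn'.le) hy
  set N : ℝ := m + k * N' with hNdef
  have hN0' : 0 ≤ N := by positivity
  have hNle : N ≤ 2 * K ^ 2 * n := by
    have h1 : (K : ℝ) ^ 2 ≤ K ^ 2 * n := le_mul_of_one_le_right (by positivity) hn1
    have h2 : (k : ℝ) * N' ≤ K ^ 2 * n := by
      have : (k : ℝ) ≤ K ^ 2 := by nlinarith
      gcongr
    linarith
  -- Three errors: the second-order term of the logarithm, the non-edges inside the component, and
  -- the deviation of the outside label count from `q * n`.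
  have e1 : N * Real.log (1 - x / n) + d * k =
      N * (Real.log (1 - x / n) + x / n) + (-(m * x / n) - k * x * ((N' - q * n) / n)) := by
    rw [hNdef, hxq]
    field_simp
    ring
  rw [e1]
  have b1 : |N * (Real.log (1 - x / n) + x / n)| ≤ 4 * K ^ 2 * X ^ 2 / n := by
    rw [abs_mul, abs_of_nonneg hN0']
    calc _ ≤ (2 * K ^ 2 * n) * (2 * (x / n) ^ 2) := by gcongr
      _ = 4 * K ^ 2 * x ^ 2 / n := by field_simp; ring
      _ ≤ _ := by gcongr
  have b2 : |(m * x / n : ℝ)| ≤ K ^ 2 * X / n := by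
    rw [abs_of_nonneg (by positivity)]
    gcongr
  have b3 : |k * x * ((N' - q * n) / n)| ≤ K * X * η := by
    rw [abs_mul, abs_of_nonneg (by positivity : (0 : ℝ) ≤ k * x), abs_div, abs_of_pos hn']
    have : |N' - q * n| / n ≤ η := (div_le_iff₀ hn').2 hN
    exact mul_le_mul (mul_le_mul hkK' hX hx0 (by positivity)) this (by positivity)
      (mul_nonneg (by positivity) (hx0.trans hX))
  calc _ ≤ _ := (abs_add_le _ _).trans (add_le_add b1 ((abs_sub _ _).trans
        (add_le_add ((abs_neg _).le.trans b2) b3)))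
    _ = _ := by ring

end Flip

/-! ### Two clusters: relabelling a small tree almost cancels the centred label -/

section TwoClusters

open scoped Classical
open Finset

variable {n : ℕ} {d p : ℝ}

lemma twoClusterMatrix_diag (d p : ℝ) (i : Fin 2) :
    twoClusterMatrix d p i i = d / twoClusterLaw p i := by
  fin_cases i <;> simp [twoClusterMatrix, twoClusterLaw, div_eq_mul_inv]

lemma twoClusterMatrix_offDiag (d p : ℝ) (i j : Fin 2) (h : i ≠ j) :
    twoClusterMatrix d p i j = 0 := by
  fin_cases i <;> fin_cases j <;> simp_all [twoClusterMatrix]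

lemma twoClusterLaw_pos (hp0 : 0 < p) (hp1 : p < 1) (i : Fin 2) : 0 < twoClusterLaw p i := by
  fin_cases i <;> simp [twoClusterLaw, hp0, hp1]

lemma sum_twoClusterLaw (p : ℝ) : ∑ i, twoClusterLaw p i = 1 := by
  simp [twoClusterLaw, Fin.sum_univ_two]

lemma div_twoClusterLaw_le (hd0 : 0 ≤ d) (hp0 : 0 < p) (hp1 : p < 1) (i : Fin 2) :
    d / twoClusterLaw p i ≤ d / (p * (1 - p)) := by
  have : 0 < p * (1 - p) := mul_pos hp0 (by linarith)
  fin_cases i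
  · refine div_le_div_of_nonneg_left hd0 this ?_
    simp only [twoClusterLaw]
    norm_num
    nlinarith
  · refine div_le_div_of_nonneg_left hd0 this ?_
    simp only [twoClusterLaw]
    norm_num
    nlinarith

lemma twoClusterMatrix_nonneg (hd0 : 0 ≤ d) (hp0 : 0 < p) (hp1 : p < 1) (i j : Fin 2) :
    0 ≤ twoClusterMatrix d p i j := by
  by_cases h : i = j
  · rw [← h, twoClusterMatrix_diag]
    exact div_nonneg hd0 (twoClusterLaw_pos hp0 hp1 i).le
  · rw [twoClusterMatrix_offDiag d p i j h]

lemma twoClusterMatrix_le (hd0 : 0 ≤ d) (hp0 : 0 < p) (hp1 : p < 1) (i j : Fin 2) :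
    twoClusterMatrix d p i j ≤ d / (p * (1 - p)) := by
  by_cases h : i = j
  · rw [← h, twoClusterMatrix_diag]
    exact div_twoClusterLaw_le hd0 hp0 hp1 i
  · rw [twoClusterMatrix_offDiag d p i j h]
    exact div_nonneg hd0 (mul_nonneg hp0.le (by linarith))

/-- The centred indicator of the label `0`. -/
noncomputable def centred (p : ℝ) (i : Fin 2) : ℝ := (if i = 0 then 1 else 0) - p

lemma abs_centred_le (hp0 : 0 < p) (hp1 : p < 1) (i : Fin 2) : |centred p i| ≤ 1 := by
  unfold centred
  rw [abs_le]
  split_ifs <;> constructor <;> linarith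

/-- Exchange the two labels on `S`. -/
noncomputable def flip (S : Finset (Fin n)) (σ : Fin n → Fin 2) : Fin n → Fin 2 :=
  fun v => if v ∈ S then (σ v).rev else σ v

lemma flip_flip (S : Finset (Fin n)) (σ : Fin n → Fin 2) : flip S (flip S σ) = σ := by
  ext v
  by_cases h : v ∈ S <;> simp [flip, h]

lemma flip_of_mem {S : Finset (Fin n)} {v : Fin n} (h : v ∈ S) (σ : Fin n → Fin 2) :
    flip S σ v = (σ v).rev := if_pos h

lemma flip_of_notMem {S : Finset (Fin n)} {v : Fin n} (h : v ∉ S) (σ : Fin n → Fin 2) :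
    flip S σ v = σ v := if_neg h

lemma outsideCount_flip (G : SimpleGraph (Fin n)) (u : Fin n) (σ : Fin n → Fin 2) (i : Fin 2) :
    outsideCount G u (flip (comp G u) σ) i = outsideCount G u σ i := by
  unfold outsideCount
  congr 1
  refine Finset.filter_congr fun v hv => ?_
  rw [flip_of_notMem (mem_compl.1 hv)]

lemma outsideDensity_flip (M : Matrix (Fin 2) (Fin 2) ℝ) (π : Fin 2 → ℝ)
    (G : SimpleGraph (Fin n)) (u : Fin n) (σ : Fin n → Fin 2) :
    outsideDensity n M π G u (flip (comp G u) σ) = outsideDensity n M π G u σ := by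
  unfold outsideDensity
  congr 1
  · exact Finset.prod_congr rfl fun v hv => by rw [flip_of_notMem (mem_compl.1 hv)]
  · refine Finset.prod_congr rfl fun e he => ?_
    simp only [mem_filter, mem_product, mem_compl] at he
    rw [flip_of_notMem he.1.1, flip_of_notMem he.1.2]

lemma outsideDensity_nonneg {s : ℕ} {M : Matrix (Fin s) (Fin s) ℝ} {π : Fin s → ℝ}
    (hπ : ∀ i, 0 ≤ π i) (hM : ∀ i j, 0 ≤ M i j) (hn : ∀ i j, M i j ≤ n)
    (G : SimpleGraph (Fin n)) (u : Fin n) (σ : Fin n → Fin s) :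
    0 ≤ outsideDensity n M π G u σ := by
  unfold outsideDensity
  refine mul_nonneg (Finset.prod_nonneg fun v _ => hπ _) (Finset.prod_nonneg fun e _ => ?_)
  split_ifs
  · exact div_nonneg (hM _ _) (Nat.cast_nonneg n)
  · rw [sub_nonneg]
    exact div_le_one_of_le₀ (hn _ _) (Nat.cast_nonneg n)

/-- The component of `u` is a tree with at most `K` vertices. -/
def IsSmallTree (K : ℕ) (G : SimpleGraph (Fin n)) (u : Fin n) : Prop :=
  (comp G u).card ≤ K ∧ (comp G u).card = (compEdges G u).card + 1

/-- The label counts outside the component of `u` are close to their means. -/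
def IsTypical (p η : ℝ) (G : SimpleGraph (Fin n)) (u : Fin n) (σ : Fin n → Fin 2) : Prop :=
  ∀ i, |(outsideCount G u σ i : ℝ) - twoClusterLaw p i * n| ≤ η * n

/-- The relative change of the density when a small tree component is relabelled. -/
noncomputable def flipError (X η : ℝ) (K n : ℕ) : ℝ :=
  2 * (K * X * η + (K ^ 2 * X + 4 * K ^ 2 * X ^ 2) / n)

lemma abs_density_flip_le (hd0 : 0 ≤ d) (hp0 : 0 < p) (hp1 : p < 1) {η : ℝ} {K : ℕ} (hn : 0 < n)
    (hXn : 2 * (d / (p * (1 - p))) ≤ n) {G : SimpleGraph (Fin n)} {u : Fin n}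
    {σ : Fin n → Fin 2} (hT : IsSmallTree K G u) (hη : IsTypical p η G u σ) :
    |density n (twoClusterMatrix d p) (twoClusterLaw p) G σ * centred p (σ u) +
      density n (twoClusterMatrix d p) (twoClusterLaw p) G (flip (comp G u) σ) *
        centred p (flip (comp G u) σ u)| ≤
    flipError (d / (p * (1 - p))) η K n *
      (density n (twoClusterMatrix d p) (twoClusterLaw p) G σ +
        density n (twoClusterMatrix d p) (twoClusterLaw p) G (flip (comp G u) σ)) := by
  have hπ0 := twoClusterLaw_pos hp0 hp1
  have hM := twoClusterMatrix_diag d p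
  have hM0 := twoClusterMatrix_offDiag d p
  set X := d / (p * (1 - p)) with hX
  have hX0 : 0 ≤ X := div_nonneg hd0 (mul_nonneg hp0.le (by linarith))
  have hn' : (0 : ℝ) < n := Nat.cast_pos.2 hn
  -- If the labels are not constant on the component, neither are the flipped ones, and both
  -- densities vanish.
  by_cases hσ : ∀ v ∈ comp G u, σ v = σ u
  swap
  · have h1 : density n (twoClusterMatrix d p) (twoClusterLaw p) G σ = 0 := by
      by_contra h
      exact hσ (label_eq_on_comp hM0 h u)
    have h2 : density n (twoClusterMatrix d p) (twoClusterLaw p) G (flip (comp G u) σ) = 0 := by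
      by_contra h
      refine hσ fun v hv => ?_
      have := label_eq_on_comp hM0 h u v hv
      rw [flip_of_mem hv, flip_of_mem (self_mem_comp G u)] at this
      exact Fin.rev_injective this
    rw [h1, h2]
    simp
  have hflip : ∀ v ∈ comp G u, flip (comp G u) σ v = (σ u).rev := fun v hv => by
    rw [flip_of_mem hv, hσ v hv]
  rw [density_eq_of_tree hπ0 hM hM0 hσ hT.2, density_eq_of_tree hπ0 hM hM0 hflip hT.2,
    outsideDensity_flip, outsideCount_flip, hflip u (self_mem_comp G u)]
  have hB0 : 0 ≤ outsideDensity n (twoClusterMatrix d p) (twoClusterLaw p) G u σ *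
      (d / n) ^ (compEdges G u).card :=
    mul_nonneg (outsideDensity_nonneg (fun i => (hπ0 i).le) (twoClusterMatrix_nonneg hd0 hp0 hp1)
      (fun i j => (twoClusterMatrix_le hd0 hp0 hp1 i j).trans (by linarith)) G u σ) (by positivity)
  set B := outsideDensity n (twoClusterMatrix d p) (twoClusterLaw p) G u σ *
      (d / n) ^ (compEdges G u).card
  let a : Fin 2 → ℝ := fun i => (((compNonedges G u).card : ℝ) +
    (comp G u).card * (outsideCount G u σ i : ℝ)) * Real.log (1 - d / twoClusterLaw p i / n)
  have hE : ∀ i, (1 - d / twoClusterLaw p i / n) ^ ((compNonedges G u).card +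
      (comp G u).card * outsideCount G u σ i) = Real.exp (a i) := by
    intro i
    have hy : d / twoClusterLaw p i / n ≤ 1 / 2 := by
      rw [div_le_iff₀ hn']
      linarith [div_twoClusterLaw_le hd0 hp0 hp1 i]
    conv_lhs => rw [← Real.exp_log (show 0 < 1 - d / twoClusterLaw p i / n by linarith)]
    rw [← Real.exp_nat_mul]
    push_cast
    rfl
  have ha : ∀ i, |a i + d * (comp G u).card| ≤ flipError X η K n / 2 := by
    intro i
    have h := abs_exponent_le (X := X) (η := η) (N' := outsideCount G u σ i) (K := K)
      (k := (comp G u).card) (m := (compNonedges G u).card) hd0 (hπ0 i) hn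
      (div_twoClusterLaw_le hd0 hp0 hp1 i) hXn (card_pos.2 ⟨u, self_mem_comp G u⟩) hT.1
      ((card_filter_le _ _).trans (card_product _ _).le) (Nat.cast_nonneg _) ?_ (hη i)
    · refine h.trans (le_of_eq ?_)
      rw [flipError]
      ring
    · have : outsideCount G u σ i ≤ n := (card_le_univ _).trans (Fintype.card_fin n).le
      exact_mod_cast this
  -- Both exponents are close to the same number `-d * k`, where `k` is the size of the component.
  have hdiff : |Real.exp (a 0) - Real.exp (a 1)| ≤
      flipError X η K n * (Real.exp (a 0) + Real.exp (a 1)) := by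
    refine (abs_exp_sub_exp_le _ _).trans (mul_le_mul_of_nonneg_right ?_ (by positivity))
    have e : a 0 - a 1 = (a 0 + d * (comp G u).card) - (a 1 + d * (comp G u).card) := by ring
    rw [e]
    refine (abs_sub _ _).trans ?_
    linarith [ha 0, ha 1]
  have hr0 : 0 ≤ flipError X η K n := by linarith [ha 0, abs_nonneg (a 0 + d * (comp G u).card)]
  -- The prior times the centred label is `p * (1 - p)` for label `0` and its negative for label
  -- `1`, so only the difference of exponentials remains.
  have hbound : |B * (p * (1 - p)) * (Real.exp (a 0) - Real.exp (a 1))| ≤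
      flipError X η K n * (B * p * Real.exp (a 0) + B * (1 - p) * Real.exp (a 1)) := by
    have hq : 0 < 1 - p := by linarith
    rw [abs_mul, abs_of_nonneg (by positivity)]
    calc _ ≤ B * (p * (1 - p)) * (flipError X η K n * (Real.exp (a 0) + Real.exp (a 1))) := by
          gcongr
      _ = flipError X η K n * (B * (p * (1 - p)) * Real.exp (a 0) +
            B * (p * (1 - p)) * Real.exp (a 1)) := by ring
      _ ≤ _ := by
          gcongr
          · exact mul_le_of_le_one_right hp0.le (by linarith)
          · exact mul_le_of_le_one_left hq.le hp1.le
  rw [hE, hE]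
  have h01 : σ u = 0 ∨ σ u = 1 := by
    generalize σ u = i
    fin_cases i <;> simp
  rcases h01 with h | h
  · rw [h]
    have e1 : (Fin.rev 0 : Fin 2) = 1 := rfl
    rw [e1]
    convert hbound using 2
    · simp [centred, twoClusterLaw]
      ring
    · simp [twoClusterLaw]
  · rw [h]
    have e1 : (Fin.rev 1 : Fin 2) = 0 := rfl
    rw [e1]
    convert hbound using 2
    · simp [centred, twoClusterLaw]
      ring
    · simp [twoClusterLaw]
      ring

lemma sum_flip (S : Finset (Fin n)) (f : (Fin n → Fin 2) → ℝ) :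
    ∑ σ, f (flip S σ) = ∑ σ, f σ :=
  Equiv.sum_comp (⟨flip S, flip S, flip_flip S, flip_flip S⟩ : Equiv.Perm (Fin n → Fin 2)) f

lemma flipError_nonneg {X η : ℝ} (hX : 0 ≤ X) (hη : 0 ≤ η) (K n : ℕ) : 0 ≤ flipError X η K n := by
  unfold flipError
  positivity

/-- For fixed `G` the flip is an involution on labellings preserving `h`, so the sum over `σ` may be
symmetrised and the paired terms nearly cancel. -/
lemma mean_mul_centred_le (hd0 : 0 ≤ d) (hp0 : 0 < p) (hp1 : p < 1) {η : ℝ} (hη0 : 0 ≤ η) {K : ℕ}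
    (hn : 0 < n) (hXn : 2 * (d / (p * (1 - p))) ≤ n) (u : Fin n)
    (hD : ∀ G σ, 0 ≤ density n (twoClusterMatrix d p) (twoClusterLaw p) G σ)
    (h : SimpleGraph (Fin n) → (Fin n → Fin 2) → ℝ) (h1 : ∀ G σ, |h G σ| ≤ 1)
    (hflip : ∀ G σ, h G (flip (comp G u) σ) = h G σ)
    (hgood : ∀ G σ, h G σ ≠ 0 → IsSmallTree K G u ∧ IsTypical p η G u σ) :
    mean n (twoClusterMatrix d p) (twoClusterLaw p) (fun G σ => h G σ * centred p (σ u)) ≤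
      flipError (d / (p * (1 - p))) η K n := by
  set r := flipError (d / (p * (1 - p))) η K n with hr
  have hr0 : 0 ≤ r :=
    flipError_nonneg (div_nonneg hd0 (mul_nonneg hp0.le (by linarith))) hη0 K n
  rw [← mean_const (n := n) (M := twoClusterMatrix d p) (sum_twoClusterLaw p) r]
  refine Finset.sum_le_sum fun G _ => ?_
  set D := density n (twoClusterMatrix d p) (twoClusterLaw p) G with hDdef
  have e1 := sum_flip (comp G u) (fun σ => D σ * (h G σ * centred p (σ u)))
  have e2 := sum_flip (comp G u) (fun σ => D σ * r)
  have key : ∑ σ, (D σ * (h G σ * centred p (σ u)) + D (flip (comp G u) σ) *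
      (h G (flip (comp G u) σ) * centred p (flip (comp G u) σ u))) ≤
      ∑ σ, (D σ * r + D (flip (comp G u) σ) * r) := by
    refine Finset.sum_le_sum fun σ _ => ?_
    rw [hflip]
    by_cases h0 : h G σ = 0
    · rw [h0]
      have := mul_nonneg (hD G σ) hr0
      have := mul_nonneg (hD G (flip (comp G u) σ)) hr0
      simp only [zero_mul, mul_zero, add_zero]
      positivity
    · have hb := abs_density_flip_le hd0 hp0 hp1 hn hXn (hgood G σ h0).1 (hgood G σ h0).2
      calc _ = h G σ * (D σ * centred p (σ u) +
            D (flip (comp G u) σ) * centred p (flip (comp G u) σ u)) := by ring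
        _ ≤ |h G σ| * |D σ * centred p (σ u) +
            D (flip (comp G u) σ) * centred p (flip (comp G u) σ u)| := by
            rw [← abs_mul]
            exact le_abs_self _
        _ ≤ 1 * (r * (D σ + D (flip (comp G u) σ))) :=
            mul_le_mul (h1 G σ) hb (abs_nonneg _) zero_le_one
        _ = _ := by ring
  rw [Finset.sum_add_distrib, Finset.sum_add_distrib, e1, e2] at key
  linarith

/-- Independent centred labels: cross terms vanish and each diagonal term is at most `1`. -/
lemma mean_sq_sum_centred_le (hp0 : 0 < p) (hp1 : p < 1) (M : Matrix (Fin 2) (Fin 2) ℝ) :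
    mean n M (twoClusterLaw p) (fun _ σ => (∑ v, centred p (σ v)) ^ 2) ≤ n := by
  rw [mean_of_labels]
  have h0 : ∀ u v, u ≠ v → ∑ σ : Fin n → Fin 2, (∏ w, twoClusterLaw p (σ w)) *
      (centred p (σ u) * centred p (σ v)) = 0 := by
    intro u v huv
    have e : ∀ σ : Fin n → Fin 2, (∏ w, twoClusterLaw p (σ w)) *
        (centred p (σ u) * centred p (σ v)) = ∏ w, (twoClusterLaw p (σ w) *
          (if w = u then centred p (σ w) else 1) * (if w = v then centred p (σ w) else 1)) := by
      intro σ
      rw [Finset.prod_mul_distrib, Finset.prod_mul_distrib]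
      simp [mul_assoc]
    rw [Finset.sum_congr rfl fun σ _ => e σ, sum_prod_label (fun w i => twoClusterLaw p i *
          (if w = u then centred p i else 1) * (if w = v then centred p i else 1))]
    refine Finset.prod_eq_zero (i := u) (mem_univ u) ?_
    simp [huv, Fin.sum_univ_two, twoClusterLaw, centred]
    ring
  have h1 : ∀ v, ∑ σ : Fin n → Fin 2, (∏ w, twoClusterLaw p (σ w)) *
      (centred p (σ v) * centred p (σ v)) ≤ 1 := by
    intro v
    calc _ ≤ ∑ σ : Fin n → Fin 2, (∏ w, twoClusterLaw p (σ w)) := by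
          refine Finset.sum_le_sum fun σ _ => mul_le_of_le_one_right
            (Finset.prod_nonneg fun w _ => (twoClusterLaw_pos hp0 hp1 _).le) ?_
          have := abs_centred_le hp0 hp1 (σ v)
          rw [← abs_mul_abs_self]
          exact mul_le_one₀ this (abs_nonneg _) this
      _ = 1 := by
          rw [sum_prod_label (fun _ i => twoClusterLaw p i)]
          simp only [sum_twoClusterLaw, prod_const_one]
  have h2 : ∀ σ : Fin n → Fin 2, (∏ w, twoClusterLaw p (σ w)) * (∑ v, centred p (σ v)) ^ 2 =
      ∑ u, ∑ v, (∏ w, twoClusterLaw p (σ w)) * (centred p (σ u) * centred p (σ v)) := by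
    intro σ
    rw [sq, Finset.sum_mul_sum, Finset.mul_sum]
    simp only [Finset.mul_sum]
  rw [Finset.sum_congr rfl fun σ _ => h2 σ, Finset.sum_comm]
  calc _ ≤ ∑ _u : Fin n, (1 : ℝ) := by
        refine Finset.sum_le_sum fun u _ => ?_
        rw [Finset.sum_comm, Finset.sum_eq_single u (fun v _ hv => h0 u v (Ne.symm hv)) (by simp)]
        exact h1 u
    _ = n := by simp

lemma outsideCount_near {G : SimpleGraph (Fin n)} {u : Fin n} (σ : Fin n → Fin 2)
    (p : ℝ) (i : Fin 2) :
    |(outsideCount G u σ i : ℝ) - twoClusterLaw p i * n| ≤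
      |∑ v, centred p (σ v)| + (comp G u).card := by
  have hcount : outsideCount G u σ i + ((comp G u).filter fun v => σ v = i).card =
      (univ.filter fun v => σ v = i).card := by
    rw [outsideCount, ← card_union_of_disjoint, ← filter_union]
    · congr 2
      rw [union_comm]
      exact union_compl _
    · exact disjoint_filter_filter (disjoint_compl_left)
  have hc : ((univ.filter fun v => σ v = i).card : ℝ) - twoClusterLaw p i * n =
      (if i = 0 then 1 else -1) * ∑ v, centred p (σ v) := by
    have h0 : ((univ.filter fun v => σ v = 0).card : ℝ) - p * n = ∑ v, centred p (σ v) := by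
      simp [centred, Finset.sum_sub_distrib, mul_comm]
    have h1 : (univ.filter fun v => σ v = 0).card + (univ.filter fun v => σ v = 1).card = n := by
      have := card_filter_add_card_filter_not (s := (univ : Finset (Fin n))) (fun v => σ v = 0)
      rw [card_univ, Fintype.card_fin] at this
      refine Eq.trans ?_ this
      congr 2
      ext v
      simp only [mem_filter, mem_univ, true_and]
      generalize σ v = j
      fin_cases j <;> simp
    have h1' : ((univ.filter fun v => σ v = 0).card : ℝ) +
      (univ.filter fun v => σ v = 1).card = n := by exact_mod_cast h1
    fin_cases i
    · simpa [twoClusterLaw] using h0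
    · simp [twoClusterLaw]
      linarith
  have h3 : ((outsideCount G u σ i : ℕ) : ℝ) + ((comp G u).filter fun v => σ v = i).card =
      (univ.filter fun v => σ v = i).card := by exact_mod_cast hcount
  have h4 : (((comp G u).filter fun v => σ v = i).card : ℝ) ≤ (comp G u).card := by
    exact_mod_cast card_filter_le _ _
  have h5 : (outsideCount G u σ i : ℝ) - twoClusterLaw p i * n =
      (if i = 0 then 1 else -1) * ∑ v, centred p (σ v) -
        ((comp G u).filter fun v => σ v = i).card := by rw [← hc]; linarith
  rw [h5]
  refine (abs_sub _ _).trans (add_le_add (le_of_eq ?_) ?_)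
  · rw [abs_mul]
    split_ifs <;> simp
  · rwa [abs_of_nonneg (Nat.cast_nonneg _)]

end TwoClusters

/-! ### Second moment bound, overlap and the limit -/

section Reconstruction

open scoped Classical
open Finset

variable {n : ℕ} {d p : ℝ}

/-- A bound on the average correlation of the centred labels of two vertices, weighted by functions
of the graph. -/
noncomputable def correlationBound (d p η : ℝ) (K n : ℕ) : ℝ :=
  flipError (d / (p * (1 - p))) η K n + 1 / (1 - d) / K +
    (∑ k ∈ range K, (2 : ℝ) ^ ((k + 1) * (k + 1)) * (2 : ℕ)) / n + 4 / (η ^ 2 * n)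

/-- A small component accounts for at most `η * n / 2` of the deviation, so the global centred sum
is at least `η * n / 2`; this feeds Chebyshev's inequality. -/
lemma one_le_of_not_isTypical {η : ℝ} (hη : 0 < η) {K : ℕ} (hn : 0 < n) (hK : 2 * K ≤ η * n)
    {G : SimpleGraph (Fin n)} {u : Fin n} {σ : Fin n → Fin 2} (hC : (comp G u).card ≤ K)
    (h : ¬ IsTypical p η G u σ) : 1 ≤ 4 / (η * n) ^ 2 * (∑ v, centred p (σ v)) ^ 2 := by
  unfold IsTypical at h
  push Not at h
  obtain ⟨i, hi⟩ := h
  have h1 := outsideCount_near (G := G) (u := u) σ p i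
  have h2 : ((comp G u).card : ℝ) ≤ K := Nat.cast_le.2 hC
  have h3 : η * n / 2 ≤ |∑ v, centred p (σ v)| := by linarith
  have hn' : (0 : ℝ) < n := Nat.cast_pos.2 hn
  have h4 : 0 < η * n := by positivity
  rw [div_mul_eq_mul_div, le_div_iff₀ (by positivity), one_mul, ← sq_abs (∑ v, _)]
  nlinarith

lemma mean_correlation_le (hd0 : 0 ≤ d) (hd1 : d < 1) (hp0 : 0 < p) (hp1 : p < 1) {η : ℝ}
    (hη : 0 < η) {K : ℕ} (hK0 : 0 < K) (hn : 0 < n) (hXn : 2 * (d / (p * (1 - p))) ≤ n)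
    (hK : 2 * K ≤ η * n) (g : SimpleGraph (Fin n) → Fin n → ℝ) (hg : ∀ G v, |g G v| ≤ 1)
    (u v : Fin n) :
    mean n (twoClusterMatrix d p) (twoClusterLaw p)
      (fun G σ => (g G u * centred p (σ u)) * (g G v * centred p (σ v))) ≤
    correlationBound d p η K n + mean n (twoClusterMatrix d p) (twoClusterLaw p)
      (fun G _ => if v ∈ comp G u then 1 else 0) := by
  have hX0 : 0 ≤ d / (p * (1 - p)) := div_nonneg hd0 (mul_nonneg hp0.le (by linarith))
  have hπ0 := twoClusterLaw_pos hp0 hp1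
  have hM := twoClusterMatrix_diag d p
  have hM0 := twoClusterMatrix_offDiag d p
  have hD : ∀ G σ, 0 ≤ density n (twoClusterMatrix d p) (twoClusterLaw p) G σ :=
    density_nonneg (fun i => (hπ0 i).le) (twoClusterMatrix_nonneg hd0 hp0 hp1)
      (fun i j => (twoClusterMatrix_le hd0 hp0 hp1 i j).trans (by linarith))
  have hK0' : (0 : ℝ) < K := Nat.cast_pos.2 hK0
  have hn' : (0 : ℝ) < n := Nat.cast_pos.2 hn
  let good : SimpleGraph (Fin n) → (Fin n → Fin 2) → Prop := fun G σ =>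
    v ∉ comp G u ∧ IsSmallTree K G u ∧ IsTypical p η G u σ
  let h : SimpleGraph (Fin n) → (Fin n → Fin 2) → ℝ := fun G σ =>
    if good G σ then g G u * (g G v * centred p (σ v)) else 0
  have hprod : ∀ (G : SimpleGraph (Fin n)) (σ : Fin n → Fin 2), |g G u * (g G v * centred p (σ v))| ≤ 1 := by
    intro G σ
    rw [abs_mul, abs_mul]
    exact mul_le_one₀ (hg G u) (by positivity)
      (mul_le_one₀ (hg G v) (abs_nonneg _) (abs_centred_le hp0 hp1 _))
  have b1 : mean n (twoClusterMatrix d p) (twoClusterLaw p)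
      (fun G σ => h G σ * centred p (σ u)) ≤ flipError (d / (p * (1 - p))) η K n := by
    refine mean_mul_centred_le hd0 hp0 hp1 hη.le hn hXn u hD h ?_ ?_ ?_
    · intro G σ
      simp only [h]
      split_ifs
      · exact hprod G σ
      · simp
    · intro G σ
      -- The good event depends on `σ` only outside the component, and `v` lies outside, so `h` is
      -- invariant under the flip.
      have e : good G (flip (comp G u) σ) ↔ good G σ := by
        simp only [good, IsTypical, outsideCount_flip]
      by_cases hgd : good G σ
      · simp only [h]
        rw [if_pos hgd, if_pos (e.2 hgd), flip_of_notMem hgd.1]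
      · simp only [h]
        rw [if_neg hgd, if_neg (fun h' => hgd (e.1 h'))]
    · intro G σ hne
      by_contra hc
      refine hne (if_neg fun h' => hc h'.2)
  have b2 := mean_card_comp_le hπ0 (sum_twoClusterLaw p) hM hM0 hd0 hd1 hD u
  have b3 := mean_cyclic_comp_le hπ0 (sum_twoClusterLaw p) hM hM0 hd0 hd1 hD u K
  have b4 := mean_sq_sum_centred_le (n := n) hp0 hp1 (twoClusterMatrix d p)
  -- Off the good event the product is at most `1`, and each way of failing makes one of the four
  -- extra terms at least `1`.
  have hpt : ∀ G σ, density n (twoClusterMatrix d p) (twoClusterLaw p) G σ ≠ 0 →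
      (g G u * centred p (σ u)) * (g G v * centred p (σ v)) ≤
      h G σ * centred p (σ u) + (1 / K * ((comp G u).card : ℝ) +
        ((if (comp G u).card ≤ K ∧ (comp G u).card ≤ (compEdges G u).card then 1 else 0) +
        (4 / (η * n) ^ 2 * (∑ v, centred p (σ v)) ^ 2 + if v ∈ comp G u then 1 else 0))) := by
    intro G σ _
    have t1 : 0 ≤ 1 / K * ((comp G u).card : ℝ) := by positivity
    have t2 : (0 : ℝ) ≤ if (comp G u).card ≤ K ∧ (comp G u).card ≤ (compEdges G u).card
      then 1 else 0 := by positivity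
    have t3 : 0 ≤ 4 / (η * n) ^ 2 * (∑ v, centred p (σ v)) ^ 2 := by positivity
    have t4 : (0 : ℝ) ≤ if v ∈ comp G u then 1 else 0 := by positivity
    by_cases hgd : good G σ
    · have : h G σ = g G u * (g G v * centred p (σ v)) := if_pos hgd
      rw [this]
      have : g G u * centred p (σ u) * (g G v * centred p (σ v)) =
        g G u * (g G v * centred p (σ v)) * centred p (σ u) := by ring
      linarith
    · have hh : h G σ = 0 := if_neg hgd
      have hle : (g G u * centred p (σ u)) * (g G v * centred p (σ v)) ≤ 1 := by
        refine (le_abs_self _).trans ?_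
        have e : g G u * centred p (σ u) * (g G v * centred p (σ v)) =
          g G u * (g G v * centred p (σ v)) * centred p (σ u) := by ring
        rw [e, abs_mul]
        exact mul_le_one₀ (hprod G σ) (abs_nonneg _) (abs_centred_le hp0 hp1 _)
      rw [hh, zero_mul, zero_add]
      by_cases c1 : v ∈ comp G u
      · rw [if_pos c1] at t4 ⊢
        linarith
      by_cases c2 : (comp G u).card ≤ K
      swap
      · have : (1 : ℝ) ≤ 1 / K * ((comp G u).card : ℝ) := by
          rw [one_div, ← div_eq_inv_mul, one_le_div hK0']
          exact_mod_cast (not_le.1 c2).le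
        linarith
      by_cases c3 : (comp G u).card ≤ (compEdges G u).card
      · rw [if_pos ⟨c2, c3⟩] at t2 ⊢
        linarith
      have c4 : ¬ IsTypical p η G u σ := fun ht =>
        hgd ⟨c1, ⟨c2, le_antisymm (card_comp_le_card_compEdges_add_one G u) (by omega)⟩, ht⟩
      linarith [one_le_of_not_isTypical hη hn hK c2 c4]
  refine (mean_le_mean hD hpt).trans ?_
  rw [mean_add, mean_add, mean_add, mean_add, mean_const_mul, mean_const_mul]
  have b2' : 1 / K * mean n (twoClusterMatrix d p) (twoClusterLaw p)
      (fun G _ => ((comp G u).card : ℝ)) ≤ 1 / (1 - d) / K := by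
    rw [one_div_mul_eq_div]
    exact div_le_div_of_nonneg_right b2 hK0'.le
  have b4' : 4 / (η * n) ^ 2 * mean n (twoClusterMatrix d p) (twoClusterLaw p)
      (fun _ σ => (∑ v, centred p (σ v)) ^ 2) ≤ 4 / (η ^ 2 * n) := by
    calc _ ≤ 4 / (η * n) ^ 2 * n := mul_le_mul_of_nonneg_left b4 (by positivity)
      _ = _ := by field_simp
  unfold correlationBound
  linarith

lemma mean_sq_sum_le (hd0 : 0 ≤ d) (hd1 : d < 1) (hp0 : 0 < p) (hp1 : p < 1) {η : ℝ}
    (hη : 0 < η) {K : ℕ} (hK0 : 0 < K) (hn : 0 < n) (hXn : 2 * (d / (p * (1 - p))) ≤ n)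
    (hK : 2 * K ≤ η * n) (g : SimpleGraph (Fin n) → Fin n → ℝ) (hg : ∀ G v, |g G v| ≤ 1) :
    mean n (twoClusterMatrix d p) (twoClusterLaw p)
      (fun G σ => (∑ v, g G v * centred p (σ v)) ^ 2) ≤
    n ^ 2 * correlationBound d p η K n + n * (1 / (1 - d)) := by
  have hX0 : 0 ≤ d / (p * (1 - p)) := div_nonneg hd0 (mul_nonneg hp0.le (by linarith))
  have hπ0 := twoClusterLaw_pos hp0 hp1
  have hD : ∀ G σ, 0 ≤ density n (twoClusterMatrix d p) (twoClusterLaw p) G σ :=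
    density_nonneg (fun i => (hπ0 i).le) (twoClusterMatrix_nonneg hd0 hp0 hp1)
      (fun i j => (twoClusterMatrix_le hd0 hp0 hp1 i j).trans (by linarith))
  simp only [sq (∑ v, _), Finset.sum_mul_sum]
  rw [mean_sum]
  calc _ ≤ ∑ _u : Fin n, (n * correlationBound d p η K n + 1 / (1 - d)) := by
        refine Finset.sum_le_sum fun u _ => ?_
        rw [mean_sum]
        refine (Finset.sum_le_sum fun v _ =>
          mean_correlation_le hd0 hd1 hp0 hp1 hη hK0 hn hXn hK g hg u v).trans ?_
        rw [Finset.sum_add_distrib, ← mean_sum]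
        refine add_le_add (by simp) ?_
        -- Summing the indicator of `v ∈ comp G u` over `v` gives the component size.
        refine le_trans (le_of_eq ?_) (mean_card_comp_le hπ0 (sum_twoClusterLaw p)
          (twoClusterMatrix_diag d p) (twoClusterMatrix_offDiag d p) hd0 hd1 hD u)
        congr 1
        ext G σ
        simp
    _ = _ := by
        simp
        ring

/-- For two labels the overlap is controlled by the empirical covariance. -/
lemma overlap_le (hn : 0 < n) (p : ℝ) (τ σ : Fin n → Fin 2) :
    overlap τ σ ≤ 2 / n * |∑ v, ((if τ v = 0 then 1 else 0) - (labelCount τ 0 : ℝ) / n) *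
      centred p (σ v)| := by
  have hn' : (0 : ℝ) < n := Nat.cast_pos.2 hn
  have ind : ∀ i : Fin 2, (if i = 1 then (1 : ℝ) else 0) = 1 - if i = 0 then 1 else 0 := by
    intro i
    fin_cases i <;> simp
  let t : Fin n → ℝ := fun v => if τ v = 0 then 1 else 0
  let x : Fin n → ℝ := fun v => if σ v = 0 then 1 else 0
  have hL0 : ∀ ρ : Fin n → Fin 2, (labelCount ρ 0 : ℝ) = ∑ v, if ρ v = 0 then 1 else 0 := by
    intro ρ
    simp [labelCount]
  have hL1 : ∀ ρ : Fin n → Fin 2,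
      (labelCount ρ 1 : ℝ) = n - ∑ v, if ρ v = 0 then (1 : ℝ) else 0 := by
    intro ρ
    have : (labelCount ρ 1 : ℝ) = ∑ v, if ρ v = 1 then (1 : ℝ) else 0 := by simp [labelCount]
    rw [this, Finset.sum_congr rfl fun v _ => ind (ρ v), Finset.sum_sub_distrib]
    simp
  have hJ : ∀ i j, (jointCount τ σ i j : ℝ) =
      ∑ v, (if τ v = i then 1 else 0) * (if σ v = j then 1 else 0) := by
    intro i j
    rw [jointCount, Finset.card_filter, Nat.cast_sum]
    refine Finset.sum_congr rfl fun v _ => ?_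
    by_cases h1 : τ v = i <;> by_cases h2 : σ v = j <;> simp [h1, h2]
  have hJ00 : (jointCount τ σ 0 0 : ℝ) = ∑ v, t v * x v := hJ 0 0
  have hJ01 : (jointCount τ σ 0 1 : ℝ) = ∑ v, t v - ∑ v, t v * x v := by
    rw [hJ, ← Finset.sum_sub_distrib]
    exact Finset.sum_congr rfl fun v _ => by rw [ind]; simp only [t, x]; ring
  have hJ10 : (jointCount τ σ 1 0 : ℝ) = ∑ v, x v - ∑ v, t v * x v := by
    rw [hJ, ← Finset.sum_sub_distrib]
    exact Finset.sum_congr rfl fun v _ => by rw [ind]; simp only [t, x]; ring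
  have hJ11 : (jointCount τ σ 1 1 : ℝ) = n - ∑ v, t v - ∑ v, x v + ∑ v, t v * x v := by
    have e : (n : ℝ) = ∑ _v : Fin n, (1 : ℝ) := by simp
    rw [hJ, e, ← Finset.sum_sub_distrib, ← Finset.sum_sub_distrib, ← Finset.sum_add_distrib]
    exact Finset.sum_congr rfl fun v _ => by rw [ind, ind]; simp only [t, x]; ring
  -- The weights sum to zero over `v`, so the centring constant `p` drops out. The identity
  -- permutation then yields `2 * C` and the transposition `-2 * C`.
  have hC : ∑ v, ((if τ v = 0 then 1 else 0) - (labelCount τ 0 : ℝ) / n) * centred p (σ v) =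
      ∑ v, t v * x v - (∑ v, t v) * (∑ v, x v) / n := by
    have e : ∀ v, ((if τ v = 0 then 1 else 0) - (labelCount τ 0 : ℝ) / n) * centred p (σ v) =
        t v * x v - p * t v - (∑ v, t v) / n * x v + (∑ v, t v) / n * p := by
      intro v
      rw [hL0, centred]
      simp only [t, x]
      ring
    rw [Finset.sum_congr rfl fun v _ => e v, Finset.sum_add_distrib, Finset.sum_sub_distrib,
      Finset.sum_sub_distrib, ← Finset.mul_sum, ← Finset.mul_sum]
    simp only [sum_const, card_univ, Fintype.card_fin, nsmul_eq_mul]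
    field_simp
    ring
  have hT0 : (labelCount τ 0 : ℝ) = ∑ v, t v := hL0 τ
  have hT1 : (labelCount τ 1 : ℝ) = n - ∑ v, t v := hL1 τ
  have hX0 : (labelCount σ 0 : ℝ) = ∑ v, x v := hL0 σ
  have hX1 : (labelCount σ 1 : ℝ) = n - ∑ v, x v := hL1 σ
  rw [hC, overlap, one_div_mul_eq_div, div_mul_eq_mul_div]
  refine div_le_div_of_nonneg_right (Finset.sup'_le _ _ fun ρ _ => ?_) hn'.le
  rw [Fin.sum_univ_two]
  set C := ∑ v, t v * x v - (∑ v, t v) * (∑ v, x v) / n with hCdef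
  have h2 : ∀ i : Fin 2, i = 0 ∨ i = 1 := fun i => by fin_cases i <;> simp
  have hne : ρ 0 ≠ ρ 1 := fun h => by simpa using ρ.injective h
  rcases h2 (ρ 0) with h0 | h0 <;> rcases h2 (ρ 1) with h1 | h1
  · exact absurd (h0.trans h1.symm) hne
  · rw [h0, h1, hJ00, hJ11, hT0, hT1, hX0, hX1]
    refine le_trans (le_of_eq ?_) (mul_le_mul_of_nonneg_left (le_abs_self C) zero_le_two)
    rw [hCdef]
    field_simp
    ring
  · rw [h0, h1, hJ01, hJ10, hT0, hT1, hX0, hX1]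
    refine le_trans (le_of_eq ?_) (mul_le_mul_of_nonneg_left (neg_le_abs C) zero_le_two)
    rw [hCdef]
    field_simp
    ring
  · exact absurd (h0.trans h1.symm) hne

lemma abs_indicator_sub_le {t c : ℝ} (ht : t = 0 ∨ t = 1) (hc0 : 0 ≤ c) (hc1 : c ≤ 1) :
    |t - c| ≤ 1 := by
  rw [abs_le]
  rcases ht with rfl | rfl <;> constructor <;> linarith

lemma successProb_nonneg {s : ℕ} {M : Matrix (Fin s) (Fin s) ℝ} {π : Fin s → ℝ}
    (hD : ∀ G σ, 0 ≤ density n M π G σ) (A : Algorithm s) (δ : ℝ) : 0 ≤ successProb M π A δ n := by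
  unfold successProb prob
  refine Finset.sum_nonneg fun G _ => Finset.sum_nonneg fun σ _ => ?_
  split_ifs
  · exact hD G σ
  · exact le_rfl

lemma prob_le_mean {s : ℕ} {M : Matrix (Fin s) (Fin s) ℝ} {π : Fin s → ℝ}
    (hD : ∀ G σ, 0 ≤ density n M π G σ) {E : SimpleGraph (Fin n) → (Fin n → Fin s) → Prop}
    {f : SimpleGraph (Fin n) → (Fin n → Fin s) → ℝ} (hf0 : ∀ G σ, 0 ≤ f G σ)
    (hf1 : ∀ G σ, E G σ → 1 ≤ f G σ) : prob n M π E ≤ mean n M π f := by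
  unfold prob mean
  refine Finset.sum_le_sum fun G _ => Finset.sum_le_sum fun σ _ => ?_
  split_ifs with h
  · exact le_mul_of_one_le_right (hD G σ) (hf1 G σ h)
  · exact mul_nonneg (hD G σ) (hf0 G σ)

lemma successProb_le (hd0 : 0 ≤ d) (hd1 : d < 1) (hp0 : 0 < p) (hp1 : p < 1) {η : ℝ}
    (hη : 0 < η) {K : ℕ} (hK0 : 0 < K) (hn : 0 < n) (hXn : 2 * (d / (p * (1 - p))) ≤ n)
    (hK : 2 * K ≤ η * n) (A : Algorithm 2) {δ : ℝ} (hδ : 0 < δ) :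
    successProb (twoClusterMatrix d p) (twoClusterLaw p) A δ n ≤
      4 / δ ^ 2 * (correlationBound d p η K n + 1 / (1 - d) / n) := by
  have hX0 : 0 ≤ d / (p * (1 - p)) := div_nonneg hd0 (mul_nonneg hp0.le (by linarith))
  have hn' : (0 : ℝ) < n := Nat.cast_pos.2 hn
  have hD : ∀ G σ, 0 ≤ density n (twoClusterMatrix d p) (twoClusterLaw p) G σ :=
    density_nonneg (fun i => (twoClusterLaw_pos hp0 hp1 i).le)
      (twoClusterMatrix_nonneg hd0 hp0 hp1)
      (fun i j => (twoClusterMatrix_le hd0 hp0 hp1 i j).trans (by linarith))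
  let g : SimpleGraph (Fin n) → Fin n → ℝ := fun G v =>
    (if A n G v = 0 then 1 else 0) - (labelCount (A n G) 0 : ℝ) / n
  have hg : ∀ G v, |g G v| ≤ 1 := by
    intro G v
    refine abs_indicator_sub_le (by split_ifs <;> simp) (by positivity) ?_
    rw [div_le_one hn']
    exact_mod_cast (card_le_univ _).trans (Fintype.card_fin n).le
  have h1 : successProb (twoClusterMatrix d p) (twoClusterLaw p) A δ n ≤
      mean n (twoClusterMatrix d p) (twoClusterLaw p)
        (fun G σ => 4 / (δ * n) ^ 2 * (∑ v, g G v * centred p (σ v)) ^ 2) := by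
    refine prob_le_mean hD (fun G σ => by positivity) fun G σ hE => ?_
    have h2 := hE.trans_le (overlap_le hn p (A n G) σ)
    change δ < 2 / n * |∑ v, g G v * centred p (σ v)| at h2
    rw [div_mul_eq_mul_div, lt_div_iff₀ hn'] at h2
    have h3 : 0 < δ * n := by positivity
    rw [div_mul_eq_mul_div, le_div_iff₀ (by positivity), one_mul, ← sq_abs (∑ v, _)]
    nlinarith
  refine h1.trans ?_
  rw [mean_const_mul]
  refine (mul_le_mul_of_nonneg_left (mean_sq_sum_le hd0 hd1 hp0 hp1 hη hK0 hn hXn hK g hg)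
    (by positivity)).trans (le_of_eq ?_)
  generalize correlationBound d p η K n = c
  generalize 1 / (1 - d) = c'
  field_simp

lemma tendsto_correlationBound (d p η : ℝ) (K : ℕ) :
    Tendsto (fun n : ℕ => correlationBound d p η K n + 1 / (1 - d) / n) atTop
      (𝓝 (2 * (K * (d / (p * (1 - p))) * η) + 1 / (1 - d) / K)) := by
  have h : ∀ c : ℝ, Tendsto (fun n : ℕ => c / (n : ℝ)) atTop (𝓝 0) :=
    tendsto_const_div_atTop_nhds_zero_nat
  have h1 := ((((h ((K : ℝ) ^ 2 * (d / (p * (1 - p))) + 4 * K ^ 2 * (d / (p * (1 - p))) ^ 2)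
    ).const_add (K * (d / (p * (1 - p))) * η)).const_mul 2).add_const (1 / (1 - d) / (K : ℝ)))
  have h2 := ((h1.add (h (∑ k ∈ range K, (2 : ℝ) ^ ((k + 1) * (k + 1)) * (2 : ℕ)))).add
    (h (4 / η ^ 2))).add (h (1 / (1 - d)))
  simp only [add_zero] at h2
  refine h2.congr fun n => ?_
  rw [correlationBound, flipError, div_div 4]

lemma tendsto_successProb (hd0 : 0 ≤ d) (hd1 : d < 1) (hp0 : 0 < p) (hp1 : p < 1)
    (A : Algorithm 2) {δ : ℝ} (hδ : 0 < δ) :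
    Tendsto (fun n : ℕ => successProb (twoClusterMatrix d p) (twoClusterLaw p) A δ n)
      atTop (𝓝 0) := by
  set X := d / (p * (1 - p)) with hX
  have hX0 : 0 ≤ X := div_nonneg hd0 (mul_nonneg hp0.le (by linarith))
  have hlarge : ∀ c : ℝ, ∀ᶠ n : ℕ in atTop, c ≤ n := fun c =>
    tendsto_natCast_atTop_atTop.eventually_ge_atTop c
  rw [Metric.tendsto_nhds]
  intro ε hε
  have hε' : 0 < ε * δ ^ 2 / 4 := by positivity
  -- Compensates the Chebyshev factor `4 / δ ^ 2`. The order of choices is `K`, then `η` depending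
  -- on `K`, then `n`.
  set ε' := ε * δ ^ 2 / 4 with hε'def
  have hd : 0 < 1 - d := by linarith
  obtain ⟨K, hK⟩ := exists_nat_gt (2 / ((1 - d) * ε'))
  have hK0' : (0 : ℝ) < K := lt_of_le_of_lt (by positivity) hK
  have hK0 : 0 < K := Nat.cast_pos.1 hK0'
  have hη : 0 < ε' / (4 * K * (X + 1)) := by positivity
  -- `X + 1` rather than `X` keeps the denominator positive when `d = 0`.
  set η := ε' / (4 * K * (X + 1)) with hηdef
  have hlim : 2 * (K * X * η) + 1 / (1 - d) / K < ε' := by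
    have a1 : 2 * (K * X * η) ≤ ε' / 2 := by
      have : 2 * (K * X * η) = ε' / 2 * (X / (X + 1)) := by
        rw [hηdef]
        field_simp
        ring
      rw [this]
      exact mul_le_of_le_one_right (by positivity) ((div_le_one (by positivity)).2 (by linarith))
    have a2 : 1 / (1 - d) / K < ε' / 2 := by
      rw [div_lt_iff₀ (by positivity)] at hK
      rw [div_div, div_lt_iff₀ (by positivity)]
      nlinarith
    linarith
  filter_upwards [(tendsto_correlationBound d p η K).eventually_lt_const hlim,
    hlarge (2 * X), hlarge (2 * K / η), eventually_gt_atTop 0] with n h1 h2 h3 h4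
  rw [div_le_iff₀ hη] at h3
  have hD : ∀ G σ, 0 ≤ density n (twoClusterMatrix d p) (twoClusterLaw p) G σ :=
    density_nonneg (fun i => (twoClusterLaw_pos hp0 hp1 i).le)
      (twoClusterMatrix_nonneg hd0 hp0 hp1)
      (fun i j => (twoClusterMatrix_le hd0 hp0 hp1 i j).trans (by linarith))
  rw [Real.dist_eq, sub_zero, abs_of_nonneg (successProb_nonneg hD A δ)]
  calc _ ≤ 4 / δ ^ 2 * (correlationBound d p η K n + 1 / (1 - d) / n) :=
        successProb_le hd0 hd1 hp0 hp1 hη hK0 h4 h2 (by linarith) A hδ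
    _ < 4 / δ ^ 2 * ε' := by gcongr
    _ = ε := by
        rw [hε'def]
        field_simp

lemma transitionMatrix_twoCluster (hd : d ≠ 0) (hp0 : 0 < p) (hp1 : p < 1) :
    transitionMatrix d (twoClusterMatrix d p) (twoClusterLaw p) = 1 := by
  ext i j
  rw [transitionMatrix, Matrix.smul_apply, Matrix.diagonal_mul, smul_eq_mul]
  by_cases h : i = j
  · have := (twoClusterLaw_pos hp0 hp1 j).ne'
    rw [h, twoClusterMatrix_diag, Matrix.one_apply_eq]
    field_simp
  · rw [twoClusterMatrix_offDiag d p i j h, Matrix.one_apply_ne h]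
    simp

end Reconstruction

end BlockModel

/-- Both eigenvalues of `T` are `1`, so `λ₂ = 1`; the model is not reconstructable; and in fact every
algorithm succeeds with probability tending to `0`, so that not even the upper limit is positive. -/
theorem mainTheorem5 (d p : ℝ) (hd0 : 0 ≤ d) (hd1 : d < 1) (hp0 : 0 < p) (hp1 : p < 1) :
    (0 < d → (BlockModel.transitionMatrix d (BlockModel.twoClusterMatrix d p)
        (BlockModel.twoClusterLaw p)).charpoly.roots = {1, 1}) ∧
    ¬ BlockModel.IsReconstructable (BlockModel.twoClusterMatrix d p)
        (BlockModel.twoClusterLaw p) ∧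
    ∀ (A : BlockModel.Algorithm 2) (δ : ℝ), 0 < δ →
      Tendsto (fun n : ℕ => BlockModel.successProb (BlockModel.twoClusterMatrix d p)
        (BlockModel.twoClusterLaw p) A δ n) atTop (𝓝 0) := by
  refine ⟨fun hd => ?_, ?_, fun A δ hδ => BlockModel.tendsto_successProb hd0 hd1 hp0 hp1 A hδ⟩
  · rw [BlockModel.transitionMatrix_twoCluster hd.ne' hp0 hp1, Matrix.charpoly_one,
      Fintype.card_fin, ← Polynomial.C_1, Polynomial.roots_pow, Polynomial.roots_X_sub_C]
    rfl
  · rintro ⟨δ, hδ, A, L, hL, hlim⟩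
    exact hL.ne' (tendsto_nhds_unique hlim
      (BlockModel.tendsto_successProb hd0 hd1 hp0 hp1 A hδ))
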